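/- **Theorem (kernel for Min-$d$-TCO($k$)).** An instance of the minimum topic-connected overlay problem (Min-TCO) consists of a finite set $U$ of users, a finite set $T$ of topics and an interest function $\mathrm{INT}\colon U\to 2^T$; write $U_t=\{u\in U : t\in \mathrm{INT}(u)\}$. A feasible solution is a set $E$ of unordered pairs of distinct users such that for every topic $t$ the subgraph of $(U,E)$ induced by $U_t$ is connected (any two of its vertices are joined by a path in it), and its cost is $|E|$. In the parameterized problem Min-$d$-TCO($k$) one is given a Min-TCO instance with $|U_t|\le d$ for all $t\in T$ and an integer $k\ge 0$, and one looks for a feasible solution of cost at most $k$. In $c$-HS($k$) one is given a finite set $X$ of elements, a system $\mathcal S$ of (pairwise distinct) subsets of $X$ of at most $c$ elements each, and an integer $k\ge 0$, and one looks for a set $H\subseteq X$ with $|H|\le k$ that meets every set of $\mathcal S$. Let $d\ge 2$ and $c=\lfloor d/2\rfloor\cdot\lceil d/2\rceil$. Then Min-$d$-TCO($k$) has a kernel of size $(2c-1)\cdot k^{c-1}+k$ (with $0^0=1$), in the form of an instance of $c$-HS whose size is measured by its number of elements. That is, there is an algorithm which, given an instance $I=(U,T,\mathrm{INT})$ of Min-TCO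 with $|U_t|\le d$ for all $t\in T$ and an integer $k\ge 0$, computes in time polynomial in $|U|+|T|+k$ an instance $J=(X,\mathcal S)$ of $c$-HS and an integer $0\le k'\le k$ such that * $|X|\le (2c-1)\cdot k^{c-1}+k$, and * $I$ has a feasible solution of cost at most $k$ if and only if $J$ has a hitting set of size at most $k'$; and there is a second algorithm which, given $I$, $k$ and any hitting set of $J$ of size at most $k'$, computes a feasible solution of $I$ of cost at most $k$, again in time polynomial in $|U|+|T|+k$. -/

import Mathlib

namespace TCOKernel

/-! ## Machine model

Programs of a WHILE language over binary trees. Every elementary step is charged the size of the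
whole tree that it is applied to (plus one), so a computation of cost `t` can be carried out by a
Turing machine in time polynomial in `t`, and conversely; "polynomial time" has its usual
meaning. -/

/-- Binary trees, the data of the WHILE language. -/
inductive Data : Type
  | nil : Data
  | cons : Data → Data → Data

namespace Data

/-- Number of nodes, the leaves included. -/
def size : Data → ℕ
  | nil => 1
  | cons a b => a.size + b.size + 1

/-- Left component, with `nil` sent to `nil`. -/
def fst : Data → Data
  | nil => nil
  | cons a _ => a

/-- Right component, with `nil` sent to `nil`. -/
def snd : Data → Data
  | nil => nil
  | cons _ b => b

/-- Truth values: `nil` is false. -/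
def ofBool : Bool → Data
  | false => nil
  | true => cons nil nil

/-- Natural numbers in unary. -/
def ofNat : ℕ → Data
  | 0 => nil
  | n + 1 => cons nil (ofNat n)

/-- Lists of trees. -/
def ofList : List Data → Data
  | [] => nil
  | a :: l => cons a (ofList l)

/-- The `m × n` bit matrix whose entry `(i, j)` tells whether `r i j` holds, row by row. -/
def ofMatrix {m n : ℕ} (r : Fin m → Fin n → Prop) [∀ i j, Decidable (r i j)] : Data :=
  ofList (List.ofFn fun i => ofList (List.ofFn fun j => ofBool (decide (r i j))))

end Data

/-- Programs; each one computes a partial function from trees to trees. -/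
inductive Prog : Type
  /-- the constant `nil` -/
  | nil : Prog
  /-- the input itself -/
  | id : Prog
  /-- left component of the input -/
  | fst : Prog
  /-- right component of the input -/
  | snd : Prog
  /-- the tree built from the results of two programs, both run on the input -/
  | pair : Prog → Prog → Prog
  /-- `comp p q` runs `q`, then `p` on its result -/
  | comp : Prog → Prog → Prog
  /-- `ite c p q` runs `p` if the test `c` gives a result other than `nil`, and `q` otherwise -/
  | ite : Prog → Prog → Prog → Prog
  /-- `loop c p` replaces the current tree by the result of `p` on it as long as the test `c`
  gives a result other than `nil` on it -/
  | loop : Prog → Prog → Prog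

/-- `Eval p x y t`: on input `x` the program `p` halts with output `y` at total cost `t`. -/
inductive Eval : Prog → Data → Data → ℕ → Prop
  | nil (x : Data) : Eval .nil x .nil (x.size + 1)
  | id (x : Data) : Eval .id x x (x.size + 1)
  | fst (x : Data) : Eval .fst x x.fst (x.size + 1)
  | snd (x : Data) : Eval .snd x x.snd (x.size + 1)
  | pair {p q : Prog} {x y z : Data} {s t : ℕ} :
      Eval p x y s → Eval q x z t → Eval (.pair p q) x (.cons y z) (s + t + (x.size + 1))
  | comp {p q : Prog} {x y z : Data} {s t : ℕ} :
      Eval q x y s → Eval p y z t → Eval (.comp p q) x z (s + t + (x.size + 1))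
  | ite_true {c p q : Prog} {x a b y : Data} {s t : ℕ} :
      Eval c x (.cons a b) s → Eval p x y t → Eval (.ite c p q) x y (s + t + (x.size + 1))
  | ite_false {c p q : Prog} {x y : Data} {s t : ℕ} :
      Eval c x .nil s → Eval q x y t → Eval (.ite c p q) x y (s + t + (x.size + 1))
  | loop_stop {c p : Prog} {x : Data} {s : ℕ} :
      Eval c x .nil s → Eval (.loop c p) x x (s + (x.size + 1))
  | loop_step {c p : Prog} {x a b y z : Data} {s t r : ℕ} :
      Eval c x (.cons a b) s → Eval p x y t → Eval (.loop c p) y z r →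
      Eval (.loop c p) x z (s + t + r + (x.size + 1))

/-- On input `x` the program `p` halts with output `y` at cost at most `T`. -/
def RunsWithin (p : Prog) (x y : Data) (T : ℕ) : Prop :=
  ∃ t ≤ T, Eval p x y t

/-! ## Minimization problems and kernels -/

/-- A minimization problem: instances with a size and an encoding, and for each instance the
candidate solutions with an encoding, the feasible ones among them, and their costs. Parameterized
by `k`, it asks for a feasible solution of cost at most `k`. -/
structure MinProblem where
  Inst : Type
  size : Inst → ℕ
  encode : Inst → Data
  Cand : Inst → Type
  encodeCand : (I : Inst) → Cand I → Data
  Feasible : (I : Inst) → Cand I → Prop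
  cost : (I : Inst) → Cand I → ℕ

namespace MinProblem

/-- `s` solves the parameterized instance `(I, k)`. -/
def Solves (A : MinProblem) (I : A.Inst) (k : ℕ) (s : A.Cand I) : Prop :=
  A.Feasible I s ∧ A.cost I s ≤ k

/-- The encoding of the parameterized instance `(I, k)`. -/
def encodeParam (A : MinProblem) (I : A.Inst) (k : ℕ) : Data :=
  .cons (A.encode I) (.ofNat k)

/-- The parameterized problem `A(k)` has kernels that are instances `(J, k')` of `B(k')` with
`order J ≤ bound k` and `k' ≤ k`: the program `K` computes an equivalent instance `(J, k')` from
`(I, k)` in polynomial time, and the program `L` transforms every solution of `(J, k')` back into a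
solution of `(I, k)` in polynomial time. -/
def HasKernel (A B : MinProblem) (order : B.Inst → ℕ) (bound : ℕ → ℕ) : Prop :=
  ∃ (K L : Prog) (T : Polynomial ℕ), ∀ (I : A.Inst) (k : ℕ), ∃ (J : B.Inst) (k' : ℕ),
    RunsWithin K (A.encodeParam I k) (B.encodeParam J k') (T.eval (A.size I + k)) ∧
    order J ≤ bound k ∧
    k' ≤ k ∧
    ((∃ s, A.Solves I k s) ↔ ∃ s', B.Solves J k' s') ∧
    ∀ s', B.Solves J k' s' → ∃ s, A.Solves I k s ∧
      RunsWithin L (.cons (A.encodeParam I k) (B.encodeCand J s')) (A.encodeCand I s)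
        (T.eval (A.size I + k))

end MinProblem

/-! ## Minimum topic-connected overlay -/

/-- An instance `(U, T, INT)`: the users and topics are numbered, and `interest u` is the set of
topics that the user `u` is interested in. -/
structure TCOInstance where
  users : ℕ
  topics : ℕ
  interest : Fin users → Finset (Fin topics)

namespace TCOInstance

/-- The set `U_t` of the users interested in the topic `t`. -/
def interested (I : TCOInstance) (t : Fin I.topics) : Finset (Fin I.users) :=
  Finset.univ.filter fun u => t ∈ I.interest u

/-- The edge set `E` consists of pairs of distinct users, and for each topic `t` the graph
`(U, E)` induces a connected graph on `U_t` (any two vertices are joined by a path). -/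
def TopicConnected (I : TCOInstance) (E : Finset (Sym2 (Fin I.users))) : Prop :=
  (∀ e ∈ E, ¬ e.IsDiag) ∧
  ∀ t : Fin I.topics,
    ((SimpleGraph.fromEdgeSet (E : Set (Sym2 (Fin I.users)))).induce
      (I.interested t : Set (Fin I.users))).Preconnected

/-- Number of users, number of topics and the interest matrix. -/
def encode (I : TCOInstance) : Data :=
  .cons (.ofNat I.users) (.cons (.ofNat I.topics) (.ofMatrix fun u t => t ∈ I.interest u))

end TCOInstance

/-- Minimum topic-connected overlay on instances with at most `d` users interested in any topic;
edge sets are encoded by adjacency matrices. -/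
def minTCO (d : ℕ) : MinProblem where
  Inst := { I : TCOInstance // ∀ t, (I.interested t).card ≤ d }
  size I := I.1.users + I.1.topics
  encode I := I.1.encode
  Cand I := Finset (Sym2 (Fin I.1.users))
  encodeCand _ E := .ofMatrix fun u v => s(u, v) ∈ E
  Feasible I E := I.1.TopicConnected E
  cost _ E := E.card

/-! ## Hitting set -/

/-- A system of (pairwise distinct) sets on finitely many numbered elements. -/
structure HSInstance where
  elements : ℕ
  numSets : ℕ
  sets : Fin numSets → Finset (Fin elements)
  distinct : Function.Injective sets

namespace HSInstance

/-- `H` meets every set of the system. -/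
def Hits (J : HSInstance) (H : Finset (Fin J.elements)) : Prop :=
  ∀ i, (J.sets i ∩ H).Nonempty

/-- Number of elements, number of sets and the incidence matrix. -/
def encode (J : HSInstance) : Data :=
  .cons (.ofNat J.elements) (.cons (.ofNat J.numSets) (.ofMatrix fun i x => x ∈ J.sets i))

end HSInstance

/-- Minimum hitting set on systems of sets of at most `c` elements each; sets of elements are
encoded by a matrix with a single row, the characteristic vector. -/
def hittingSet (c : ℕ) : MinProblem where
  Inst := { J : HSInstance // ∀ i, (J.sets i).card ≤ c }
  size J := J.1.elements + J.1.numSets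
  encode J := J.1.encode
  Cand J := Finset (Fin J.1.elements)
  encodeCand _ H := .ofMatrix fun (_ : Fin 1) x => x ∈ H
  Feasible J H := J.1.Hits H
  cost _ H := H.card

end TCOKernel

/-!
A set of edges is a topic-connected overlay if and only if, for every topic `t`, it contains an
edge across every cut of `U_t` into two nonempty parts (`meets_cuts_of_topicConnected`,
`topicConnected_of_meets_cuts`). A cut of a set of at most `d` users has at most
`c = ⌊d/2⌋ ⌈d/2⌉` edges, so an overlay is a hitting set of a polynomially large family `F` of sets
of at most `c` edges, and it remains to shrink the ground set of `F`. Only the case `2 ≤ c`,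
`1 ≤ k` needs an idea; in the other cases it suffices to count the sets.

*Heavy sets.* Call a family weakly related if no member contains another one and any two members
have fewer than `c - 1` common elements. If more than `k ^ (c - 1 - |S|)` members of such a family
contain `S`, while this fails for every larger set in place of `S`, then every hitting set of size
at most `k` meets `S` (`meets_heaviest`), because the members containing `S` would otherwise be
distributed among at most `k` sets `S ∪ {x}`. Hence `S` may replace all its supersets. When this
is no longer possible, the empty set is not heavy, so the weakly related families under
consideration have at most `k ^ (c - 1)` members (`length_weak_reduced_le`).

*Crown.* Let `W` be a maximal weakly related subfamily and `V` its union, so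
`|V| ≤ c k ^ (c - 1)`. By maximality, a set that is not contained in `V` has one element `x` outside
`V` and `c - 1` elements inside (`outer_inner_spec`), and thus is an edge from `x` to a set
`S ⊆ V` in a bipartite graph. The edges of a matching of this graph are weakly related again, so
the matching has at most `k ^ (c - 1)` edges. An auction yields a matching together with prices
such that, for some price level that does not occur, the right ends `S` above this level are all
matched, their partners have no neighbours below, and the unmatched left ends have all their
neighbours above (`auction_spec`, `AuctionInv.aboveGap_closed`,
`AuctionInv.aboveGap_of_unmatched`). Let the right ends above the level replace their
supersets. This is sound, since a partner of `S` in a hitting set may be exchanged for an element of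
`S` (`exists_meets_contract_crown`), and afterwards only matched elements are left outside `V`
(`mem_core_or_mem_outer`). So `(c + 1) k ^ (c - 1)` elements remain in all, which is at most
`(2 c - 1) k ^ (c - 1)`.

Replacing sets by subsets never destroys the property that a hitting set of the kernel is a hitting
set of `F`, so solutions are translated back by naming edges. For the running time, the functions
between encoded types that some program computes in polynomial time (`PolyTime`) are shown to be
closed under the list operations from which the algorithm is put together; the one source of loops
is `PolyTime.foldl`, where the intermediate values have to be bounded.
-/

namespace TCOKernel

/-! ### Encoded types and polynomial-time functions -/

/-- Types whose elements are represented by trees. -/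
class Enc (α : Type) where
  /-- the tree representing an element -/
  enc : α → Data

open Enc

instance : Enc ℕ := ⟨Data.ofNat⟩
instance : Enc Bool := ⟨Data.ofBool⟩
instance {α β : Type} [Enc α] [Enc β] : Enc (α × β) := ⟨fun p => .cons (enc p.1) (enc p.2)⟩
instance {α : Type} [Enc α] : Enc (List α) := ⟨fun l => .ofList (l.map enc)⟩

/-- Number of nodes of the tree that represents `a`. -/
def esize {α : Type} [Enc α] (a : α) : ℕ := (enc a).size

/-- `PolyTime f`: some program computes `f` in time polynomial in the size of the encoded
argument. -/
@[fun_prop]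
def PolyTime {α β : Type} [Enc α] [Enc β] (f : α → β) : Prop :=
  ∃ (p : Prog) (T : Polynomial ℕ), ∀ a, RunsWithin p (enc a) (enc (f a)) (T.eval (esize a))

theorem eval_mono (P : Polynomial ℕ) {m n : ℕ} (h : m ≤ n) : P.eval m ≤ P.eval n := by
  induction P using Polynomial.induction_on' with
  | add p q hp hq => simp only [Polynomial.eval_add]; omega
  | monomial i a => simp only [Polynomial.eval_monomial]; gcongr

theorem Eval.size_le {p : Prog} {x y : Data} {t : ℕ} (h : Eval p x y t) :
    x.size ≤ t ∧ y.size ≤ t := by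
  induction h with
  | nil x => simp [Data.size]
  | id x => omega
  | fst x => cases x <;> simp [Data.size, Data.fst]; omega
  | snd x => cases x <;> simp [Data.size, Data.snd]; omega
  | _ => (try simp only [Data.size] at *); omega

namespace RunsWithin

variable {p q r : Prog} {x y z : Data} {S T : ℕ}

theorem mono (h : RunsWithin p x y S) (hST : S ≤ T) : RunsWithin p x y T :=
  let ⟨t, ht, e⟩ := h
  ⟨t, ht.trans hST, e⟩

theorem size_le (h : RunsWithin p x y T) : y.size ≤ T :=
  let ⟨_, ht, e⟩ := h
  e.size_le.2.trans ht

theorem pair (hp : RunsWithin p x y S) (hq : RunsWithin q x z T) :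
    RunsWithin (.pair p q) x (.cons y z) (S + T + (x.size + 1)) :=
  let ⟨_, hs, e⟩ := hp
  let ⟨_, ht, e'⟩ := hq
  ⟨_, by omega, e.pair e'⟩

theorem comp (hq : RunsWithin q x y S) (hp : RunsWithin p y z T) :
    RunsWithin (.comp p q) x z (S + T + (x.size + 1)) :=
  let ⟨_, hs, e⟩ := hq
  let ⟨_, ht, e'⟩ := hp
  ⟨_, by omega, e.comp e'⟩

theorem fst : RunsWithin .fst x x.fst (x.size + 1) := ⟨_, le_rfl, .fst x⟩

theorem snd : RunsWithin .snd x x.snd (x.size + 1) := ⟨_, le_rfl, .snd x⟩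

end RunsWithin

section Basic

variable {Γ α β δ : Type} [Enc Γ] [Enc α] [Enc β] [Enc δ]

theorem esize_pair (a : α) (b : β) : esize (a, b) = esize a + esize b + 1 := rfl

theorem esize_nil : esize ([] : List α) = 1 := rfl

theorem esize_cons (a : α) (l : List α) : esize (a :: l) = esize a + esize l + 1 := rfl

theorem esize_bool (b : Bool) : esize b ≤ 3 := by
  cases b <;> simp [esize, enc, Data.ofBool, Data.size]

theorem esize_nat (n : ℕ) : esize n = 2 * n + 1 := by
  induction n with
  | zero => rfl
  | succ n ih => change 1 + esize n + 1 = _; omega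

@[fun_prop]
theorem PolyTime.id : PolyTime (fun a : α => a) :=
  ⟨.id, .X + 1, fun a => ⟨_, by simp [esize], .id _⟩⟩

theorem exists_prog_const (D : Data) :
    ∃ (p : Prog) (T : Polynomial ℕ), ∀ x : Data, RunsWithin p x D (T.eval x.size) := by
  induction D with
  | nil => exact ⟨.nil, .X + 1, fun x => ⟨_, by simp, .nil _⟩⟩
  | cons a b ha hb =>
    obtain ⟨p, S, hp⟩ := ha
    obtain ⟨q, T, hq⟩ := hb
    exact ⟨.pair p q, S + T + (.X + 1), fun x => ((hp x).pair (hq x)).mono (by simp)⟩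

@[fun_prop]
theorem PolyTime.const (b : β) : PolyTime (fun _ : α => b) :=
  let ⟨p, T, h⟩ := exists_prog_const (enc b)
  ⟨p, T, fun a => h (enc a)⟩

@[fun_prop]
theorem PolyTime.comp {g : β → δ} {f : α → β} (hg : PolyTime g) (hf : PolyTime f) :
    PolyTime (fun a => g (f a)) := by
  obtain ⟨p, S, hp⟩ := hf
  obtain ⟨q, T, hq⟩ := hg
  refine ⟨.comp q p, S + T.comp S + (.X + 1), fun a => ((hp a).comp (hq (f a))).mono ?_⟩
  have := eval_mono T (hp a).size_le
  simp only [Polynomial.eval_add, Polynomial.eval_comp, Polynomial.eval_X, Polynomial.eval_one]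
  unfold esize at *
  omega

@[fun_prop]
theorem PolyTime.prodMk {f : Γ → α} {g : Γ → β} (hf : PolyTime f) (hg : PolyTime g) :
    PolyTime (fun a => (f a, g a)) := by
  obtain ⟨p, S, hp⟩ := hf
  obtain ⟨q, T, hq⟩ := hg
  exact ⟨.pair p q, S + T + (.X + 1), fun a => ((hp a).pair (hq a)).mono (by simp [esize])⟩

theorem PolyTime.fst_self : PolyTime (fun p : α × β => p.1) :=
  ⟨.fst, .X + 1, fun _ => RunsWithin.fst.mono (by simp [esize])⟩

theorem PolyTime.snd_self : PolyTime (fun p : α × β => p.2) :=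
  ⟨.snd, .X + 1, fun _ => RunsWithin.snd.mono (by simp [esize])⟩

@[fun_prop]
theorem PolyTime.fst {f : Γ → α × β} (hf : PolyTime f) : PolyTime (fun a => (f a).1) :=
  PolyTime.fst_self.comp hf

@[fun_prop]
theorem PolyTime.snd {f : Γ → α × β} (hf : PolyTime f) : PolyTime (fun a => (f a).2) :=
  PolyTime.snd_self.comp hf

@[fun_prop]
theorem PolyTime.cons {f : Γ → α} {g : Γ → List α} (hf : PolyTime f) (hg : PolyTime g) :
    PolyTime (fun a => f a :: g a) :=
  hf.prodMk hg

/-- Every program bounds the size of its output by its running time. -/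
theorem PolyTime.esize_le {f : α → β} (hf : PolyTime f) :
    ∃ T : Polynomial ℕ, ∀ a, esize (f a) ≤ T.eval (esize a) :=
  let ⟨_, T, h⟩ := hf
  ⟨T, fun a => (h a).size_le⟩

@[fun_prop]
theorem PolyTime.cond {c : Γ → Bool} {f g : Γ → α} (hc : PolyTime c) (hf : PolyTime f)
    (hg : PolyTime g) : PolyTime (fun a => bif c a then f a else g a) := by
  obtain ⟨p, S, hp⟩ := hc
  obtain ⟨q, T, hq⟩ := hf
  obtain ⟨r, R, hr⟩ := hg
  refine ⟨.ite p q r, S + T + R + (.X + 1), fun a => ?_⟩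
  obtain ⟨s, hs, e⟩ := hp a
  obtain ⟨t, ht, e'⟩ := hq a
  obtain ⟨u, hu, e''⟩ := hr a
  simp only [Polynomial.eval_add, Polynomial.eval_X, Polynomial.eval_one]
  unfold esize at *
  cases h : c a <;> rw [h] at e
  · exact ⟨s + u + ((enc a).size + 1), by omega, .ite_false e e''⟩
  · exact ⟨s + t + ((enc a).size + 1), by omega, .ite_true e e'⟩

@[fun_prop]
theorem PolyTime.tail {f : Γ → List α} (hf : PolyTime f) : PolyTime (fun a => (f a).tail) := by
  refine PolyTime.comp (g := fun l : List α => l.tail) ⟨.snd, .X + 1, fun l => ?_⟩ hf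
  have := RunsWithin.snd (x := enc l)
  cases l <;> exact this.mono (by simp [esize])

@[fun_prop]
theorem PolyTime.headD {f : Γ → List α} {b : Γ → α} (hf : PolyTime f) (hb : PolyTime b) :
    PolyTime (fun a => (f a).headD (b a)) := by
  refine PolyTime.comp (g := fun p : List α × α => p.1.headD p.2) ?_ (hf.prodMk hb)
  refine ⟨.ite .fst (.comp .fst .fst) .snd, .C 5 * (.X + 1), fun p => ?_⟩
  obtain ⟨l, b⟩ := p
  have h1 := Eval.fst (enc (l, b))
  have h2 := Eval.snd (enc (l, b))
  have h3 := Eval.fst (enc l)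
  have h4 := esize_pair l b
  cases l with
  | nil => exact ⟨_, by simp [esize] at *; omega, .ite_false h1 h2⟩
  | cons a l => exact ⟨_, by simp [esize] at *; omega, .ite_true h1 (h1.comp h3)⟩

@[fun_prop]
theorem PolyTime.isEmpty {f : Γ → List α} (hf : PolyTime f) :
    PolyTime (fun a => (f a).isEmpty) := by
  refine PolyTime.comp (g := fun l : List α => l.isEmpty) ?_ hf
  refine ⟨.ite .id .nil (.pair .nil .nil), .C 5 * (.X + 1), fun l => ?_⟩
  have h1 := Eval.id (enc l)
  have h2 := Eval.nil (enc l)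
  cases l with
  | nil => exact ⟨_, by simp [esize] at *; omega, .ite_false h1 (h2.pair h2)⟩
  | cons a l => exact ⟨_, by simp [esize] at *; omega, .ite_true h1 h2⟩

theorem length_le_esize (l : List α) : l.length < esize l := by
  induction l with
  | nil => simp [esize_nil]
  | cons a l ih => simp [esize_cons]; omega

theorem esize_le_of_mem {l : List α} {a : α} (h : a ∈ l) : esize a < esize l := by
  induction l with
  | nil => simp at h
  | cons b l ih =>
    rw [esize_cons]
    rcases List.mem_cons.1 h with rfl | h
    · omega
    · have := ih h; omega

theorem esize_list_le {l : List α} {n m : ℕ} (hl : l.length ≤ n) (h : ∀ a ∈ l, esize a ≤ m) :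
    esize l ≤ n * (m + 1) + 1 := by
  have : esize l ≤ l.length * (m + 1) + 1 := by
    clear hl
    induction l with
    | nil => simp [esize_nil]
    | cons b l ih =>
      have h1 := ih fun a ha => h a (List.mem_cons_of_mem _ ha)
      have h2 := h b List.mem_cons_self
      rw [esize_cons, List.length_cons, Nat.add_mul]
      omega
  exact this.trans (by gcongr)

theorem esize_sublist {l₁ l₂ : List α} (h : l₁.Sublist l₂) : esize l₁ ≤ esize l₂ := by
  induction h with
  | slnil => rfl
  | cons a _ ih => rw [esize_cons]; omega
  | cons_cons a _ ih => rw [esize_cons, esize_cons]; omega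

/-! ### Iteration along lists -/

/-- The program that runs through a list: on trees `(γ, rest, acc)` it iterates a program `p` that
computes the new value of `acc` from `γ`, `acc` and the first entry of `rest`. -/
def foldProg (p : Prog) : Prog :=
  .loop (.comp .fst .snd)
    (.pair .fst (.pair (.comp .snd (.comp .fst .snd))
      (.comp p (.pair .fst (.pair (.comp .snd .snd) (.comp .fst (.comp .fst .snd)))))))

/-- If the encodings of `γ`, the list and all intermediate values add up to less than `N`, then
each of the at most `esize l` rounds costs at most `30 * (N + 1)` for taking apart and rebuilding
the tree `(γ, rest, acc)`, and `T.eval N` for the step. -/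
theorem runsWithin_foldProg {p : Prog} {T : Polynomial ℕ} {f : Γ → β → α → β}
    (hp : ∀ x : Γ × β × α,
      RunsWithin p (enc x) (enc (f x.1 x.2.1 x.2.2)) (T.eval (esize x)))
    (γ : Γ) (q N : ℕ) (l : List α) (b : β)
    (hq : ∀ l₁ l₂, l = l₁ ++ l₂ → esize (l₁.foldl (f γ) b) ≤ q)
    (hN : esize γ + esize l + q + 2 ≤ N) :
    RunsWithin (foldProg p) (enc (γ, l, b)) (enc (γ, ([] : List α), l.foldl (f γ) b))
      (esize l * (30 * (N + 1) + T.eval N)) := by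
  induction l generalizing b with
  | nil =>
    have h0 := hq [] [] rfl
    have h1 := (Eval.snd (enc (γ, ([] : List α), b))).comp (Eval.fst _)
    refine ⟨_, ?_, Eval.loop_stop h1⟩
    have e1 : esize (γ, ([] : List α), b) ≤ N := by
      simp only [esize_pair]; simp at h0; omega
    have e2 : esize (([] : List α), b) ≤ N := by
      simp only [esize_pair] at *; omega
    change esize (γ, ([] : List α), b) + 1 + (esize (([] : List α), b) + 1) +
      (esize (γ, ([] : List α), b) + 1) + (esize (γ, ([] : List α), b) + 1) ≤ _
    rw [esize_nil]
    omega
  | cons a l ih =>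
    have h0 : esize b ≤ q := hq [] (a :: l) rfl
    have hpre : ∀ l₁ l₂, l = l₁ ++ l₂ → esize (l₁.foldl (f γ) (f γ b a)) ≤ q := by
      intro l₁ l₂ h
      exact hq (a :: l₁) l₂ (by rw [h]; rfl)
    have hal := esize_cons a l
    obtain ⟨t, ht, e⟩ := ih (f γ b a) hpre (by omega)
    obtain ⟨s, hs, e'⟩ := hp (γ, b, a)
    have e1 : esize (γ, a :: l, b) ≤ N := by simp only [esize_pair]; omega
    have e2 : esize (a :: l, b) ≤ N := by simp only [esize_pair] at *; omega
    have e3 : esize (γ, b, a) ≤ N := by simp only [esize_pair] at *; omega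
    have e4 : esize (a :: l) ≤ N := by omega
    have hsN := hs.trans (eval_mono T e3)
    have E1 := Eval.fst (enc (γ, a :: l, b))
    have E2 := Eval.snd (enc (γ, a :: l, b))
    have E3 := E2.comp (Eval.fst (enc (a :: l, b)))
    have E4 := E2.comp (Eval.snd (enc (a :: l, b)))
    have E5 := E3.comp (Eval.fst (enc (a :: l)))
    have E6 := E3.comp (Eval.snd (enc (a :: l)))
    have E7 := E1.pair (E6.pair ((E1.pair (E4.pair E5)).comp e'))
    refine ⟨_, ?_, Eval.loop_step E3 E7 e⟩
    change esize (γ, a :: l, b) + 1 + (esize (a :: l, b) + 1) + (esize (γ, a :: l, b) + 1) +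
      (esize (γ, a :: l, b) + 1 +
        (esize (γ, a :: l, b) + 1 + (esize (a :: l, b) + 1) + (esize (γ, a :: l, b) + 1) +
          (esize (a :: l) + 1) + (esize (γ, a :: l, b) + 1) +
        (esize (γ, a :: l, b) + 1 + (esize (γ, a :: l, b) + 1 + (esize (a :: l, b) + 1) +
          (esize (γ, a :: l, b) + 1) +
          (esize (γ, a :: l, b) + 1 + (esize (a :: l, b) + 1) + (esize (γ, a :: l, b) + 1) +
          (esize (a :: l) + 1) + (esize (γ, a :: l, b) + 1)) +
          (esize (γ, a :: l, b) + 1)) + (esize (γ, a :: l, b) + 1) + s +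
          (esize (γ, a :: l, b) + 1)) + (esize (γ, a :: l, b) + 1)) +
        (esize (γ, a :: l, b) + 1)) + t + (esize (γ, a :: l, b) + 1) ≤ _
    have hmul : (esize l + 1) * (30 * (N + 1) + T.eval N) ≤
        esize (a :: l) * (30 * (N + 1) + T.eval N) := by
      gcongr; omega
    rw [Nat.add_mul] at hmul
    omega

/-- Iterating a polynomial-time step along a list takes polynomial time, provided that the
intermediate values stay polynomially small. -/
theorem PolyTime.foldl {f : Γ → β → α → β} {b : Γ → β} {l : Γ → List α}
    (hf : PolyTime fun x : Γ × β × α => f x.1 x.2.1 x.2.2) (hb : PolyTime b) (hl : PolyTime l)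
    (hQ : ∃ Q : Polynomial ℕ, ∀ γ l₁ l₂, l γ = l₁ ++ l₂ →
      esize (l₁.foldl (f γ) (b γ)) ≤ Q.eval (esize γ)) :
    PolyTime fun γ => (l γ).foldl (f γ) (b γ) := by
  obtain ⟨p, T, hp⟩ := hf
  obtain ⟨Q, hQ⟩ := hQ
  obtain ⟨R, hR⟩ := hl.esize_le
  have hin : PolyTime fun γ => (γ, l γ, b γ) := by fun_prop
  have hout : PolyTime fun x : Γ × List α × β => x.2.2 := by fun_prop
  let N : Polynomial ℕ := .X + R + Q + 2
  have hloop : ∃ (p : Prog) (T : Polynomial ℕ), ∀ γ, RunsWithin p (enc (γ, l γ, b γ))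
      (enc (γ, ([] : List α), (l γ).foldl (f γ) (b γ))) (T.eval (esize γ)) := by
    refine ⟨foldProg p, R * (30 * (N + 1) + T.comp N), fun γ => ?_⟩
    refine (runsWithin_foldProg hp γ (Q.eval (esize γ)) (N.eval (esize γ)) (l γ) (b γ)
      (hQ γ) ?_).mono ?_
    · simp only [N, Polynomial.eval_add, Polynomial.eval_X, Polynomial.eval_ofNat]
      have := hR γ
      omega
    · simp only [Polynomial.eval_add, Polynomial.eval_mul, Polynomial.eval_comp,
        Polynomial.eval_one, Polynomial.eval_ofNat]
      gcongr
      exact hR γ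
  obtain ⟨p₁, T₁, h₁⟩ := hin
  obtain ⟨p₂, T₂, h₂⟩ := hloop
  obtain ⟨p₃, T₃, h₃⟩ := hout
  refine ⟨.comp p₃ (.comp p₂ p₁), T₁ + T₂ + T₃.comp T₂ + 2 * (.X + 1), fun γ => ?_⟩
  refine (((h₁ γ).comp (h₂ γ)).comp (h₃ (γ, [], (l γ).foldl (f γ) (b γ)))).mono ?_
  have := eval_mono T₃ (h₂ γ).size_le
  simp only [Polynomial.eval_add, Polynomial.eval_comp, Polynomial.eval_X, Polynomial.eval_one,
    Polynomial.eval_mul, Polynomial.eval_ofNat]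
  unfold esize at *
  omega

end Basic

/-! ### Operations on lists and numbers -/

section Lists

variable {Γ α β δ : Type} [Enc Γ] [Enc α] [Enc β] [Enc δ]

theorem esize_perm {l₁ l₂ : List α} (h : l₁.Perm l₂) : esize l₁ = esize l₂ := by
  induction h with
  | nil => rfl
  | cons a _ ih => rw [esize_cons, esize_cons, ih]
  | swap a b l => simp only [esize_cons]; omega
  | trans _ _ ih₁ ih₂ => exact ih₁.trans ih₂

@[fun_prop]
theorem PolyTime.reverse {l : Γ → List α} (hl : PolyTime l) :
    PolyTime fun γ => (l γ).reverse := by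
  have : ∀ l₁ : List α, l₁.foldl (fun acc a => a :: acc) [] = l₁.reverse := by
    intro l₁
    simp [List.foldl_flip_cons_eq_append]
  refine PolyTime.comp (g := fun l : List α => l.reverse) ?_ hl
  simp only [← this]
  refine PolyTime.foldl (f := fun _ acc a => a :: acc) (by fun_prop) (by fun_prop) (by fun_prop)
    ⟨.X, fun l l₁ l₂ h => ?_⟩
  rw [this, Polynomial.eval_X, esize_perm l₁.reverse_perm, h]
  exact esize_sublist (List.sublist_append_left l₁ l₂)

theorem PolyTime.foldr {f : Γ → α → β → β} {b : Γ → β} {l : Γ → List α}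
    (hf : PolyTime fun x : Γ × α × β => f x.1 x.2.1 x.2.2) (hb : PolyTime b) (hl : PolyTime l)
    (hQ : ∃ Q : Polynomial ℕ, ∀ γ l₁ l₂, l γ = l₁ ++ l₂ →
      esize (l₂.foldr (f γ) (b γ)) ≤ Q.eval (esize γ)) :
    PolyTime fun γ => (l γ).foldr (f γ) (b γ) := by
  obtain ⟨Q, hQ⟩ := hQ
  simp only [List.foldr_eq_foldl_reverse]
  refine PolyTime.foldl (f := fun γ acc a => f γ a acc)
    (PolyTime.comp (g := fun x : Γ × α × β => f x.1 x.2.1 x.2.2)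
      (f := fun x : Γ × β × α => (x.1, x.2.2, x.2.1)) hf (by fun_prop)) hb (by fun_prop)
    ⟨Q, fun γ l₁ l₂ h => ?_⟩
  have := hQ γ l₂.reverse l₁.reverse (by rw [← List.reverse_append, ← h, List.reverse_reverse])
  rwa [List.foldr_eq_foldl_reverse, List.reverse_reverse] at this

@[fun_prop]
theorem PolyTime.map {f : Γ → α → β} {l : Γ → List α}
    (hf : PolyTime fun x : Γ × α => f x.1 x.2) (hl : PolyTime l) :
    PolyTime fun γ => (l γ).map (f γ) := by
  obtain ⟨T, hT⟩ := hf.esize_le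
  obtain ⟨R, hR⟩ := hl.esize_le
  simp only [List.map_eq_foldr]
  refine PolyTime.foldr (f := fun γ a acc => f γ a :: acc)
    (PolyTime.cons (hf.comp (by fun_prop : PolyTime fun x : Γ × α × List β => (x.1, x.2.1)))
      (by fun_prop)) (by fun_prop) hl ⟨R * (T.comp (.X + R + 1) + 1) + 1, fun γ l₁ l₂ h => ?_⟩
  rw [← List.map_eq_foldr]
  simp only [Polynomial.eval_add, Polynomial.eval_mul, Polynomial.eval_comp, Polynomial.eval_one,
    Polynomial.eval_X]
  have hs : esize l₂ ≤ R.eval (esize γ) :=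
    (esize_sublist (h ▸ List.sublist_append_right l₁ l₂)).trans (hR γ)
  refine esize_list_le ?_ ?_
  · rw [List.length_map]
    exact (length_le_esize l₂).le.trans hs
  · simp only [List.mem_map, forall_exists_index, and_imp, forall_apply_eq_imp_iff₂]
    intro a ha
    refine (hT (γ, a)).trans (eval_mono T ?_)
    have := esize_le_of_mem ha
    rw [esize_pair]
    omega

@[fun_prop]
theorem PolyTime.append {f g : Γ → List α} (hf : PolyTime f) (hg : PolyTime g) :
    PolyTime fun γ => f γ ++ g γ := by
  obtain ⟨S, hS⟩ := hf.esize_le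
  obtain ⟨T, hT⟩ := hg.esize_le
  have : ∀ l₁ l₂ : List α, l₁ ++ l₂ = l₁.foldr (fun a acc => a :: acc) l₂ := by simp
  simp only [this]
  refine PolyTime.foldr (f := fun _ a acc => a :: acc) (by fun_prop) hg hf
    ⟨S + T, fun γ l₁ l₂ h => ?_⟩
  have h1 : esize l₂ ≤ S.eval (esize γ) :=
    (esize_sublist (h ▸ List.sublist_append_right l₁ l₂)).trans (hS γ)
  have h2 := hT γ
  have h3 : ∀ l₁ l₂ : List α,
      esize (l₁.foldr (fun a acc => a :: acc) l₂) ≤ esize l₁ + esize l₂ := by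
    intro l₁ l₂
    induction l₁ with
    | nil => simp
    | cons a l ih => simp only [List.foldr_cons, esize_cons] at *; omega
  rw [Polynomial.eval_add]
  exact (h3 _ _).trans (by omega)

theorem esize_flatten (L : List (List α)) : esize L.flatten ≤ esize L := by
  have h3 : ∀ l₁ l₂ : List α, esize (l₁ ++ l₂) ≤ esize l₁ + esize l₂ := by
    intro l₁ l₂
    induction l₁ with
    | nil => simp
    | cons a l ih => simp only [List.cons_append, esize_cons] at *; omega
  induction L with
  | nil => simp [esize_nil]
  | cons l L ih =>
    rw [List.flatten_cons, esize_cons]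
    have := h3 l L.flatten
    omega

@[fun_prop]
theorem PolyTime.flatten {l : Γ → List (List α)} (hl : PolyTime l) :
    PolyTime fun γ => (l γ).flatten := by
  obtain ⟨S, hS⟩ := hl.esize_le
  have : ∀ L : List (List α), L.flatten = L.foldr (fun a acc => a ++ acc) [] := by
    intro L; induction L <;> simp [*]
  simp only [this]
  refine PolyTime.foldr (f := fun _ a acc => a ++ acc) (by fun_prop) (by fun_prop) hl
    ⟨S, fun γ l₁ l₂ h => ?_⟩
  rw [← this]
  exact (esize_flatten l₂).trans
    ((esize_sublist (h ▸ List.sublist_append_right l₁ l₂)).trans (hS γ))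

@[fun_prop]
theorem PolyTime.flatMap {f : Γ → α → List β} {l : Γ → List α}
    (hf : PolyTime fun x : Γ × α => f x.1 x.2) (hl : PolyTime l) :
    PolyTime fun γ => (l γ).flatMap (f γ) := by
  simp only [List.flatMap_def]
  exact PolyTime.flatten (PolyTime.map hf hl)

@[fun_prop]
theorem PolyTime.filter {f : Γ → α → Bool} {l : Γ → List α}
    (hf : PolyTime fun x : Γ × α => f x.1 x.2) (hl : PolyTime l) :
    PolyTime fun γ => (l γ).filter (f γ) := by
  have : ∀ (p : α → Bool) (L : List α),
      L.filter p = L.flatMap fun a => bif p a then [a] else [] := by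
    intro p L
    induction L with
    | nil => rfl
    | cons a L ih => rw [List.filter_cons, List.flatMap_cons, ← ih]; cases p a <;> rfl
  simp only [this]
  exact PolyTime.flatMap (PolyTime.cond hf (by fun_prop) (by fun_prop)) hl

@[fun_prop]
theorem PolyTime.not {f : Γ → Bool} (hf : PolyTime f) : PolyTime fun γ => !(f γ) := by
  have : ∀ a : Bool, (!a) = bif a then false else true := by decide
  simp only [this]
  fun_prop

@[fun_prop]
theorem PolyTime.and {f g : Γ → Bool} (hf : PolyTime f) (hg : PolyTime g) :
    PolyTime fun γ => f γ && g γ := by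
  have : ∀ a b : Bool, (a && b) = bif a then b else false := by decide
  simp only [this]
  fun_prop

@[fun_prop]
theorem PolyTime.or {f g : Γ → Bool} (hf : PolyTime f) (hg : PolyTime g) :
    PolyTime fun γ => f γ || g γ := by
  have : ∀ a b : Bool, (a || b) = bif a then true else b := by decide
  simp only [this]
  fun_prop

@[fun_prop]
theorem PolyTime.any {f : Γ → α → Bool} {l : Γ → List α}
    (hf : PolyTime fun x : Γ × α => f x.1 x.2) (hl : PolyTime l) :
    PolyTime fun γ => (l γ).any (f γ) := by
  have : ∀ (p : α → Bool) (L : List α), L.any p = !(L.filter p).isEmpty := by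
    intro p L
    induction L with
    | nil => rfl
    | cons a L ih => rw [List.any_cons, ih, List.filter_cons]; cases p a <;> simp
  simp only [this]
  exact PolyTime.not (PolyTime.isEmpty (PolyTime.filter hf hl))

@[fun_prop]
theorem PolyTime.all {f : Γ → α → Bool} {l : Γ → List α}
    (hf : PolyTime fun x : Γ × α => f x.1 x.2) (hl : PolyTime l) :
    PolyTime fun γ => (l γ).all (f γ) := by
  simp only [List.all_eq_not_any_not]
  exact PolyTime.not (PolyTime.any (PolyTime.not hf) hl)

theorem enc_replicate (n : ℕ) : enc (List.replicate n (0 : ℕ)) = enc n := by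
  induction n with
  | zero => rfl
  | succ n ih => exact congrArg (Data.cons .nil) ih

/-- Numbers are encoded as lists of empty trees, so a number and the list of that many zeros have
the same encoding; this reduces arithmetic to operations on lists. -/
@[fun_prop]
theorem PolyTime.unary {n : Γ → ℕ} (hn : PolyTime n) :
    PolyTime fun γ => List.replicate (n γ) (0 : ℕ) :=
  let ⟨p, T, h⟩ := hn
  ⟨p, T, fun γ => enc_replicate (n γ) ▸ h γ⟩

@[fun_prop]
theorem PolyTime.length {l : Γ → List α} (hl : PolyTime l) : PolyTime fun γ => (l γ).length := by
  have : PolyTime fun γ => (l γ).map fun _ => (0 : ℕ) := by fun_prop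
  simp only [List.map_const'] at this
  obtain ⟨p, T, h⟩ := this
  exact ⟨p, T, fun γ => enc_replicate (l γ).length ▸ h γ⟩

@[fun_prop]
theorem PolyTime.succ {n : Γ → ℕ} (hn : PolyTime n) : PolyTime fun γ => n γ + 1 := by
  have : PolyTime fun γ => (0 :: List.replicate (n γ) (0 : ℕ)).length := by fun_prop
  simpa using this

@[fun_prop]
theorem PolyTime.mul {m n : Γ → ℕ} (hm : PolyTime m) (hn : PolyTime n) :
    PolyTime fun γ => m γ * n γ := by
  have : PolyTime fun γ =>
      ((List.replicate (m γ) (0 : ℕ)).flatMap fun _ => List.replicate (n γ) (0 : ℕ)).length := by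
    fun_prop
  simpa using this

@[fun_prop]
theorem PolyTime.drop {n : Γ → ℕ} {l : Γ → List α} (hn : PolyTime n) (hl : PolyTime l) :
    PolyTime fun γ => (l γ).drop (n γ) := by
  obtain ⟨S, hS⟩ := hl.esize_le
  have : ∀ (n : ℕ) (L : List α),
      (List.replicate n 0).foldl (fun (l : List α) (_ : ℕ) => l.tail) L = L.drop n := by
    intro n
    induction n with
    | zero => simp
    | succ n ih => intro L; rw [List.replicate_succ, List.foldl_cons, ih]; simp
  simp only [← this]
  refine PolyTime.foldl (f := fun _ (l : List α) (_ : ℕ) => l.tail) (by fun_prop) hl (by fun_prop)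
    ⟨S, fun γ l₁ l₂ h => ?_⟩
  obtain ⟨m, -, rfl⟩ : ∃ m, l₁.length = m ∧ l₁ = List.replicate m 0 :=
    ⟨_, rfl, List.eq_replicate_iff.2 ⟨rfl, fun b hb => List.eq_of_mem_replicate
      (h ▸ List.mem_append_left l₂ hb)⟩⟩
  rw [this]
  exact (esize_sublist (List.drop_sublist _ _)).trans (hS γ)

@[fun_prop]
theorem PolyTime.getD {n : Γ → ℕ} {l : Γ → List α} {b : Γ → α} (hn : PolyTime n)
    (hl : PolyTime l) (hb : PolyTime b) : PolyTime fun γ => (l γ).getD (n γ) (b γ) := by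
  have : ∀ (L : List α) (n : ℕ) (b : α), L.getD n b = (L.drop n).headD b := by
    intro L n b
    simp [List.headD_eq_head?_getD]
  simp only [this]
  fun_prop

@[fun_prop]
theorem PolyTime.ltNat {m n : Γ → ℕ} (hm : PolyTime m) (hn : PolyTime n) :
    PolyTime fun γ => decide (m γ < n γ) := by
  have : PolyTime fun γ => !((List.replicate (n γ) (0 : ℕ)).drop (m γ)).isEmpty := by fun_prop
  convert this using 2 with γ
  rw [Bool.eq_iff_iff]
  simp [List.drop_replicate, Nat.sub_eq_zero_iff_le]

@[fun_prop]
theorem PolyTime.range {n : Γ → ℕ} (hn : PolyTime n) : PolyTime fun γ => List.range (n γ) := by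
  obtain ⟨S, hS⟩ := hn.esize_le
  have : ∀ L : List ℕ,
      L.foldr (fun _ (l : List ℕ) => 0 :: l.map fun i => i + 1) [] = List.range L.length := by
    intro L
    induction L with
    | nil => rfl
    | cons a L ih => rw [List.foldr_cons, ih, List.length_cons, List.range_succ_eq_map]
  have h2 : ∀ γ, List.range (n γ) = List.range (List.replicate (n γ) (0 : ℕ)).length := by simp
  simp only [h2, ← this]
  refine PolyTime.foldr (f := fun _ _ (l : List ℕ) => 0 :: l.map fun i => i + 1) (by fun_prop)
    (by fun_prop) (by fun_prop) ⟨S * (S + 1) + 1, fun γ l₁ l₂ h => ?_⟩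
  have h3 := congrArg List.length h
  rw [List.length_replicate, List.length_append] at h3
  have h4 := hS γ
  rw [esize_nat] at h4
  rw [this]
  simp only [Polynomial.eval_add, Polynomial.eval_mul, Polynomial.eval_one]
  refine esize_list_le (List.length_range.trans_le (by omega)) fun a ha => ?_
  rw [List.mem_range] at ha
  rw [esize_nat]
  omega

theorem PolyTime.iterate {f : Γ → β → β} {n : Γ → ℕ} {b : Γ → β}
    (hf : PolyTime fun x : Γ × β => f x.1 x.2) (hn : PolyTime n) (hb : PolyTime b)
    (hQ : ∃ Q : Polynomial ℕ, ∀ γ i, i ≤ n γ → esize ((f γ)^[i] (b γ)) ≤ Q.eval (esize γ)) :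
    PolyTime fun γ => (f γ)^[n γ] (b γ) := by
  obtain ⟨Q, hQ⟩ := hQ
  have : ∀ (g : β → β) (L : List ℕ) (b : β), L.foldl (fun x _ => g x) b = g^[L.length] b := by
    intro g L
    induction L with
    | nil => simp
    | cons a L ih =>
      intro b
      rw [List.foldl_cons, ih, List.length_cons, Function.iterate_succ_apply]
  have h2 : ∀ γ, (f γ)^[n γ] (b γ) = (f γ)^[(List.replicate (n γ) (0 : ℕ)).length] (b γ) := by simp
  simp only [h2, ← this]
  refine PolyTime.foldl (f := fun γ x (_ : ℕ) => f γ x)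
    (hf.comp (by fun_prop : PolyTime fun x : Γ × β × ℕ => (x.1, x.2.1))) hb (by fun_prop)
    ⟨Q, fun γ l₁ l₂ h => ?_⟩
  have h3 := congrArg List.length h
  rw [List.length_replicate, List.length_append] at h3
  rw [this]
  exact hQ γ _ (by omega)

@[fun_prop]
theorem PolyTime.take_one {l : Γ → List α} (hl : PolyTime l) : PolyTime fun γ => (l γ).take 1 := by
  obtain ⟨S, hS⟩ := hl.esize_le
  have : ∀ L : List α, L.foldr (fun a _ => [a]) [] = L.take 1 := by
    intro L
    cases L <;> simp
  simp only [← this]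
  refine PolyTime.foldr (f := fun _ a _ => [a]) (by fun_prop) (by fun_prop) hl
    ⟨S, fun γ l₁ l₂ h => ?_⟩
  rw [this]
  exact (esize_sublist ((List.take_sublist _ _).trans
    (h ▸ List.sublist_append_right l₁ l₂))).trans (hS γ)

/-- Types with a polynomial-time equality test. -/
class PolyEq (α : Type) [Enc α] [DecidableEq α] : Prop where
  polyTime_eq : PolyTime fun p : α × α => decide (p.1 = p.2)

@[fun_prop]
theorem PolyTime.eq [DecidableEq α] [PolyEq α] {f g : Γ → α} (hf : PolyTime f) (hg : PolyTime g) :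
    PolyTime fun γ => decide (f γ = g γ) :=
  PolyEq.polyTime_eq.comp (hf.prodMk hg)

instance : PolyEq ℕ where
  polyTime_eq := by
    have : PolyTime fun p : ℕ × ℕ => !decide (p.1 < p.2) && !decide (p.2 < p.1) := by fun_prop
    convert this using 2 with p
    rw [Bool.eq_iff_iff]
    simp
    omega

instance [DecidableEq α] [DecidableEq β] [PolyEq α] [PolyEq β] : PolyEq (α × β) where
  polyTime_eq := by
    have : PolyTime fun p : (α × β) × (α × β) =>
      decide (p.1.1 = p.2.1) && decide (p.1.2 = p.2.2) := by fun_prop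
    convert this using 2 with p
    rw [Bool.eq_iff_iff]
    simp [Prod.ext_iff]

end Lists

/-! ### Greedy subfamilies and sublists -/

section Greedy

variable {Γ α : Type} [Enc Γ] [Enc α]

/-- A maximal sublist in which no entry stands in the relation `r` to a later one. -/
def greedy {α : Type} (r : α → α → Bool) (L : List α) : List α :=
  L.foldr (fun e acc => bif acc.any (r e) then acc else e :: acc) []

/-- All sublists of a list of length at most `n`, and some sublists of a longer list. The recursion
is on a bound `n` rather than on the list, so that for fixed `n` it takes polynomial time. -/
def subl {α : Type} : ℕ → List α → List (List α)
  | 0, _ => [[]]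
  | n + 1, l => subl n l.tail ++ (l.take 1).flatMap fun a => (subl n l.tail).map fun s => a :: s

theorem greedy_cons {α : Type} (r : α → α → Bool) (e : α) (L : List α) :
    greedy r (e :: L) = bif (greedy r L).any (r e) then greedy r L else e :: greedy r L := rfl

theorem greedy_sublist {α : Type} (r : α → α → Bool) (L : List α) : (greedy r L).Sublist L := by
  induction L with
  | nil => exact List.Sublist.slnil
  | cons e L ih =>
    rw [greedy_cons]
    cases (greedy r L).any (r e)
    · exact ih.cons_cons e
    · exact ih.cons e

@[fun_prop]
theorem PolyTime.greedy {r : Γ → α → α → Bool} {L : Γ → List α}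
    (hr : PolyTime fun x : Γ × α × α => r x.1 x.2.1 x.2.2) (hL : PolyTime L) :
    PolyTime fun γ => greedy (r γ) (L γ) := by
  obtain ⟨S, hS⟩ := hL.esize_le
  refine PolyTime.foldr (b := fun _ => [])
    (f := fun γ e acc => bif acc.any (r γ e) then acc else e :: acc) ?_
    (by fun_prop) hL ⟨S, fun γ l₁ l₂ h => ?_⟩
  · refine PolyTime.cond (PolyTime.any
      (hr.comp (by fun_prop : PolyTime fun x : (Γ × α × List α) × α => (x.1.1, x.1.2.1, x.2)))
      (by fun_prop)) (by fun_prop) (by fun_prop)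
  · exact (esize_sublist ((greedy_sublist (r γ) l₂).trans
      (h ▸ List.sublist_append_right l₁ l₂))).trans (hS γ)

@[fun_prop]
theorem PolyTime.subl {n : ℕ} {l : Γ → List α} (hl : PolyTime l) :
    PolyTime fun γ => subl n (l γ) := by
  induction n generalizing l with
  | zero => exact PolyTime.const _
  | succ n ih =>
    have := ih hl.tail
    unfold TCOKernel.subl
    have h2 := this.comp (PolyTime.fst_self (α := Γ) (β := α))
    fun_prop

/-- Only exponents bounded by a constant `m` occur, so recursion on `m` takes polynomial time. -/
@[fun_prop]
theorem PolyTime.powSub {m : ℕ} {k : Γ → ℕ} {l : Γ → List α} (hk : PolyTime k)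
    (hl : PolyTime l) : PolyTime fun γ => k γ ^ (m - (l γ).length) := by
  induction m generalizing l with
  | zero => simp only [Nat.zero_sub, pow_zero]; fun_prop
  | succ m ih =>
    have h1 := ih hl.tail
    have h2 := ih (PolyTime.const ([] : List α))
    have : ∀ γ, k γ ^ (m + 1 - (l γ).length) = bif (l γ).isEmpty
        then k γ * k γ ^ (m - ([] : List α).length) else k γ ^ (m - (l γ).tail.length) := by
      intro γ
      cases l γ with
      | nil => simp [pow_succ, mul_comm]
      | cons a l => simp
    simp only [this]
    fun_prop

end Greedy

/-! ### Set systems as lists of lists -/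

section SetSystem

variable {Γ α : Type} [Enc Γ] [Enc α] [DecidableEq α]

/-- Inclusion of lists regarded as sets. -/
def subs {α : Type} [DecidableEq α] (l₁ l₂ : List α) : Bool := l₁.all fun a => decide (a ∈ l₂)

/-- Equality of lists regarded as sets. -/
def setEq (l₁ l₂ : List α) : Bool := subs l₁ l₂ && subs l₂ l₁

/-- Put the sets of `P` in place of their supersets in `F`. -/
def contract (P F : List (List α)) : List (List α) :=
  P ++ F.filter fun e => P.all fun S => !subs S e

/-- Two sets that are not weakly related: the first is contained in the second, or they have at
least `c - 1` elements in common. Inclusion is listed separately so that sets with fewer than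
`c - 1` elements conflict with themselves too. -/
def conflict (c : ℕ) (e f : List α) : Bool :=
  subs e f || decide (c < (e.filter fun a => decide (a ∈ f)).length + 2)

/-- A maximal weakly related subfamily. -/
def weak (c : ℕ) (F : List (List α)) : List (List α) := greedy (conflict c) F

/-- A set `S` is heavy in `Z` if more than `k ^ (c - 1 - |S|)` members of `Z` contain it. -/
def heavy (c k : ℕ) (Z : List (List α)) (S : List α) : Bool :=
  decide (k ^ (c - 1 - S.length) < (Z.filter fun e => subs S e).length)

/-- The heavy subsets of members of `Z`. -/
def heavies (c k : ℕ) (Z : List (List α)) : List (List α) :=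
  (Z.flatMap (subl c)).filter (heavy c k Z)

/-- A heavy set of maximum size, as a list with at most one entry. -/
def heaviest (c k : ℕ) (Z : List (List α)) : List (List α) :=
  ((heavies c k Z).filter fun S =>
    (heavies c k Z).all fun S' => !decide (S.length < S'.length)).take 1

variable [PolyEq α]

@[fun_prop]
theorem PolyTime.mem {a : Γ → α} {l : Γ → List α} (ha : PolyTime a) (hl : PolyTime l) :
    PolyTime fun γ => decide (a γ ∈ l γ) := by
  have : PolyTime fun γ => (l γ).any fun b => decide (a γ = b) := by fun_prop
  convert this using 2 with γ
  rw [Bool.eq_iff_iff]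
  simp

@[fun_prop]
theorem PolyTime.subs {f g : Γ → List α} (hf : PolyTime f) (hg : PolyTime g) :
    PolyTime fun γ => subs (f γ) (g γ) := by
  unfold TCOKernel.subs
  fun_prop

@[fun_prop]
theorem PolyTime.setEq {f g : Γ → List α} (hf : PolyTime f) (hg : PolyTime g) :
    PolyTime fun γ => setEq (f γ) (g γ) := by
  unfold TCOKernel.setEq
  fun_prop

@[fun_prop]
theorem PolyTime.contract {f g : Γ → List (List α)} (hf : PolyTime f) (hg : PolyTime g) :
    PolyTime fun γ => contract (f γ) (g γ) := by
  unfold TCOKernel.contract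
  fun_prop

@[fun_prop]
theorem PolyTime.conflict {c : ℕ} {f g : Γ → List α} (hf : PolyTime f) (hg : PolyTime g) :
    PolyTime fun γ => conflict c (f γ) (g γ) := by
  unfold TCOKernel.conflict
  fun_prop

@[fun_prop]
theorem PolyTime.weak {c : ℕ} {F : Γ → List (List α)} (hF : PolyTime F) :
    PolyTime fun γ => weak c (F γ) := by
  unfold TCOKernel.weak
  exact PolyTime.greedy (r := fun _ => TCOKernel.conflict c) (by fun_prop) hF

@[fun_prop]
theorem PolyTime.heavy {c : ℕ} {k : Γ → ℕ} {Z : Γ → List (List α)} {S : Γ → List α}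
    (hk : PolyTime k) (hZ : PolyTime Z) (hS : PolyTime S) :
    PolyTime fun γ => heavy c (k γ) (Z γ) (S γ) := by
  unfold TCOKernel.heavy
  fun_prop

@[fun_prop]
theorem PolyTime.heavies {c : ℕ} {k : Γ → ℕ} {Z : Γ → List (List α)}
    (hk : PolyTime k) (hZ : PolyTime Z) : PolyTime fun γ => heavies c (k γ) (Z γ) := by
  unfold TCOKernel.heavies
  fun_prop

@[fun_prop]
theorem PolyTime.heaviest {c : ℕ} {k : Γ → ℕ} {Z : Γ → List (List α)}
    (hk : PolyTime k) (hZ : PolyTime Z) : PolyTime fun γ => heaviest c (k γ) (Z γ) := by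
  unfold TCOKernel.heaviest
  fun_prop

end SetSystem

/-! ### The auction -/

section Auction

/-- Entries of `st` that may bid: a state lists the edges of a bipartite graph, each with the price
of its right end and a flag that marks the edges of the current matching; `sL` and `sR` tell
whether two edges have the same left or right end. An edge may bid if its price is below `N`, its
left end is unmatched, and no edge with this left end is cheaper. -/
def bidders {ε : Type} (sL : ε → ε → Bool) (N : ℕ) (st : List (ε × ℕ × Bool)) :
    List (ε × ℕ × Bool) :=
  st.filter fun a => decide (a.2.1 < N) && !(st.any fun b => b.2.2 && sL b.1 a.1) &&
    st.all fun b => !(sL a.1 b.1 && decide (b.2.1 < a.2.1))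

/-- One step of the auction: the first bidder, if there is one, is matched to its right end,
replacing a previous partner, and the price of this right end is raised by one. -/
def bid {ε : Type} (sL sR : ε → ε → Bool) (N : ℕ) (st : List (ε × ℕ × Bool)) :
    List (ε × ℕ × Bool) :=
  st.map fun b => bif ((bidders sL N st).take 1).any (fun a => sR a.1 b.1)
    then (b.1, b.2.1 + 1, ((bidders sL N st).take 1).any fun a => sL a.1 b.1) else b

/-- The auction, run until no bidders are left: every step raises the price of some edge, and prices
do not exceed `E.length + 1`. -/
def auction {ε : Type} (sL sR : ε → ε → Bool) (E : List ε) : List (ε × ℕ × Bool) :=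
  (bid sL sR (E.length + 1))^[E.length * (E.length + 1)] (E.map fun e => (e, 0, false))

/-- The edges whose price exceeds some positive price that no edge has. -/
def aboveGap {ε : Type} (N : ℕ) (st : List (ε × ℕ × Bool)) : List (ε × ℕ × Bool) :=
  st.filter fun a => (List.range N).any fun g =>
    decide (0 < g) && decide (g < a.2.1) && st.all fun b => !decide (b.2.1 = g)

theorem map_fst_bid {ε : Type} (sL sR : ε → ε → Bool) (N : ℕ) (st : List (ε × ℕ × Bool)) :
    (bid sL sR N st).map Prod.fst = st.map Prod.fst := by
  rw [bid, List.map_map]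
  refine List.map_congr_left fun b _ => ?_
  rw [Function.comp_apply]
  cases ((bidders sL N st).take 1).any fun a => sR a.1 b.1 <;> rfl

theorem map_fst_iterate_bid {ε : Type} (sL sR : ε → ε → Bool) (N i : ℕ)
    (st : List (ε × ℕ × Bool)) : ((bid sL sR N)^[i] st).map Prod.fst = st.map Prod.fst := by
  induction i with
  | zero => rfl
  | succ i ih => rw [Function.iterate_succ_apply', map_fst_bid, ih]

theorem price_le_of_mem_iterate_bid {ε : Type} (sL sR : ε → ε → Bool) (N i : ℕ) (E : List ε) :
    ∀ a ∈ (bid sL sR N)^[i] (E.map fun e => (e, 0, false)), a.2.1 ≤ i := by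
  induction i with
  | zero => simp
  | succ i ih =>
    rw [Function.iterate_succ_apply']
    intro a ha
    obtain ⟨b, hb, rfl⟩ := List.mem_map.1 ha
    have := ih b hb
    cases (((bidders sL N ((bid sL sR N)^[i] (E.map fun e => (e, 0, false)))).take 1).any
      fun a => sR a.1 b.1)
    · exact this.trans (Nat.le_succ i)
    · exact Nat.succ_le_succ this

variable {Γ ε : Type} [Enc Γ] [Enc ε]

@[fun_prop]
theorem PolyTime.bidders {sL : Γ → ε → ε → Bool} {N : Γ → ℕ} {st : Γ → List (ε × ℕ × Bool)}
    (hL : PolyTime fun x : Γ × ε × ε => sL x.1 x.2.1 x.2.2) (hN : PolyTime N)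
    (hst : PolyTime st) : PolyTime fun γ => bidders (sL γ) (N γ) (st γ) := by
  unfold TCOKernel.bidders
  refine PolyTime.filter (PolyTime.and (PolyTime.and (by fun_prop)
    (PolyTime.not (PolyTime.any (PolyTime.and (by fun_prop) (hL.comp
      (by fun_prop : PolyTime fun x : (Γ × ε × ℕ × Bool) × ε × ℕ × Bool =>
        (x.1.1, x.2.1, x.1.2.1)))) (by fun_prop))))
    (PolyTime.all (PolyTime.not (PolyTime.and (hL.comp
      (by fun_prop : PolyTime fun x : (Γ × ε × ℕ × Bool) × ε × ℕ × Bool =>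
        (x.1.1, x.1.2.1, x.2.1))) (by fun_prop))) (by fun_prop))) hst

@[fun_prop]
theorem PolyTime.bid {sL sR : Γ → ε → ε → Bool} {N : Γ → ℕ} {st : Γ → List (ε × ℕ × Bool)}
    (hL : PolyTime fun x : Γ × ε × ε => sL x.1 x.2.1 x.2.2)
    (hR : PolyTime fun x : Γ × ε × ε => sR x.1 x.2.1 x.2.2) (hN : PolyTime N)
    (hst : PolyTime st) : PolyTime fun γ => bid (sL γ) (sR γ) (N γ) (st γ) := by
  unfold TCOKernel.bid
  have hB := PolyTime.take_one (PolyTime.bidders hL hN hst)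
  have hB' := hB.comp (PolyTime.fst_self (α := Γ) (β := ε × ℕ × Bool))
  have hproj : PolyTime fun x : (Γ × ε × ℕ × Bool) × ε × ℕ × Bool =>
    (x.1.1, x.2.1, x.1.2.1) := by fun_prop
  refine PolyTime.map (PolyTime.cond (PolyTime.any (hR.comp hproj) hB')
    (PolyTime.prodMk (by fun_prop) (PolyTime.prodMk (by fun_prop)
      (PolyTime.any (hL.comp hproj) hB'))) (by fun_prop)) hst

@[fun_prop]
theorem PolyTime.auction {sL sR : Γ → ε → ε → Bool} {E : Γ → List ε}
    (hL : PolyTime fun x : Γ × ε × ε => sL x.1 x.2.1 x.2.2)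
    (hR : PolyTime fun x : Γ × ε × ε => sR x.1 x.2.1 x.2.2) (hE : PolyTime E) :
    PolyTime fun γ => auction (sL γ) (sR γ) (E γ) := by
  obtain ⟨S, hS⟩ := hE.esize_le
  unfold TCOKernel.auction
  refine PolyTime.iterate (f := fun γ st => TCOKernel.bid (sL γ) (sR γ) ((E γ).length + 1) st)
    (PolyTime.bid (hL.comp (by fun_prop : PolyTime fun x : (Γ × List (ε × ℕ × Bool)) × ε × ε =>
        (x.1.1, x.2.1, x.2.2)))
      (hR.comp (by fun_prop : PolyTime fun x : (Γ × List (ε × ℕ × Bool)) × ε × ε =>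
        (x.1.1, x.2.1, x.2.2))) (by fun_prop) (by fun_prop)) (by fun_prop) (by fun_prop)
    ⟨S * (S + 2 * (S * (S + 1)) + 1 + 3 + 2 + 1) + 1, fun γ i hi => ?_⟩
  have hlen := length_le_esize (E γ)
  have hSγ := hS γ
  have hmap := map_fst_iterate_bid (sL γ) (sR γ) ((E γ).length + 1) i
    ((E γ).map fun e => (e, 0, false))
  rw [List.map_map] at hmap
  change _ = List.map _root_.id (E γ) at hmap
  rw [List.map_id] at hmap
  simp only [Polynomial.eval_add, Polynomial.eval_mul, Polynomial.eval_one,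
    Polynomial.eval_ofNat]
  refine esize_list_le ?_ fun a ha => ?_
  · have := congrArg List.length hmap
    rw [List.length_map] at this
    exact this.le.trans (by omega)
  · have h1 : a.1 ∈ E γ := hmap ▸ List.mem_map_of_mem ha
    have h2 := price_le_of_mem_iterate_bid _ _ _ _ _ a ha
    have h3 := esize_le_of_mem h1
    have h4 := esize_bool a.2.2
    have h5 : (E γ).length * ((E γ).length + 1) ≤
        S.eval (esize γ) * (S.eval (esize γ) + 1) := by gcongr <;> omega
    obtain ⟨e, p, b⟩ := a
    rw [esize_pair, esize_pair, esize_nat]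
    simp only at h1 h2 h3 h4
    omega

@[fun_prop]
theorem PolyTime.aboveGap {N : Γ → ℕ} {st : Γ → List (ε × ℕ × Bool)} (hN : PolyTime N)
    (hst : PolyTime st) : PolyTime fun γ => aboveGap (N γ) (st γ) := by
  unfold TCOKernel.aboveGap
  fun_prop

end Auction

/-! ### The kernelization of hitting set -/

section Kernel

variable {Γ α : Type} [Enc Γ] [Enc α] [DecidableEq α] [PolyEq α]

/-- The elements of `e` outside `V`. -/
def outer {α : Type} [DecidableEq α] (V e : List α) : List α := e.filter fun a => !decide (a ∈ V)

/-- The elements of `e` inside `V`. -/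
def inner {α : Type} [DecidableEq α] (V e : List α) : List α := e.filter fun a => decide (a ∈ V)

/-- The outer elements of `e` belong to `f`. -/
def sameOuter {α : Type} [DecidableEq α] (V e f : List α) : Bool := subs (outer V e) f

/-- The inner elements of `e` belong to `f`. -/
def sameInner {α : Type} [DecidableEq α] (V e f : List α) : Bool := subs (inner V e) f

/-- The elements covered by the maximal weakly related subfamily. -/
def core {α : Type} [DecidableEq α] (c : ℕ) (F : List (List α)) : List α := (weak c F).flatten

/-- The outcome of the auction in the bipartite graph of the sets not contained in the core; each
of them joins its element outside the core to the set of its elements in the core. -/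
def outerAuction {α : Type} [DecidableEq α] (c : ℕ) (F : List (List α)) :
    List (List α × ℕ × Bool) :=
  auction (sameOuter (core c F)) (sameInner (core c F)) (F.filter fun e => !subs e (core c F))

/-- The matching found by the auction; a matched pair of ends may be listed several times, as
different lists with the same elements. -/
def matched {α : Type} [DecidableEq α] (c : ℕ) (F : List (List α)) : List (List α) :=
  ((outerAuction c F).filter fun a => a.2.2).map fun a => a.1

/-- The cores of the crown: right ends of the bipartite graph whose price lies above a gap. -/
def crown {α : Type} [DecidableEq α] (c : ℕ) (F : List (List α)) : List (List α) :=
  (aboveGap ((F.filter fun e => !subs e (core c F)).length + 1) (outerAuction c F)).map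
    fun a => inner (core c F) a.1

/-- A weakly related family: the greedy one if it is large, and the one made from the matching
otherwise. -/
def witness {α : Type} [DecidableEq α] (c k : ℕ) (F : List (List α)) : List (List α) :=
  bif decide (k ^ (c - 1) < (weak c F).length) then weak c F else weak c (matched c F)

/-- One reduction step: a heaviest set replaces its supersets. -/
def reduce {α : Type} [DecidableEq α] (c k : ℕ) (F : List (List α)) : List (List α) :=
  contract (heaviest c k (witness c k F)) F

/-- The family reduced until no heavy sets are left: for `k ≠ 0` every reduction step that changes
the family makes it shorter. -/
def reduced {α : Type} [DecidableEq α] (c k : ℕ) (F : List (List α)) : List (List α) :=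
  (reduce c k)^[F.length] F

/-- The sets of the kernel. If `c < 2` or `k = 0`, more than `k` distinct sets of at most `c`
elements have no hitting set of size `k`, and the family consisting of the empty set is returned. -/
def kernelSets {α : Type} [DecidableEq α] (c k : ℕ) (F : List (List α)) : List (List α) :=
  bif decide (c < 2) || decide (k = 0)
    then (bif decide (k < (greedy setEq F).length) then [[]] else greedy setEq F)
    else greedy setEq (contract (crown c (reduced c k F)) (reduced c k F))

@[fun_prop]
theorem PolyTime.outer {V e : Γ → List α} (hV : PolyTime V) (he : PolyTime e) :
    PolyTime fun γ => outer (V γ) (e γ) := by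
  unfold TCOKernel.outer
  fun_prop

@[fun_prop]
theorem PolyTime.inner {V e : Γ → List α} (hV : PolyTime V) (he : PolyTime e) :
    PolyTime fun γ => inner (V γ) (e γ) := by
  unfold TCOKernel.inner
  fun_prop

@[fun_prop]
theorem PolyTime.sameOuter {V e f : Γ → List α} (hV : PolyTime V) (he : PolyTime e)
    (hf : PolyTime f) : PolyTime fun γ => sameOuter (V γ) (e γ) (f γ) := by
  unfold TCOKernel.sameOuter
  fun_prop

@[fun_prop]
theorem PolyTime.sameInner {V e f : Γ → List α} (hV : PolyTime V) (he : PolyTime e)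
    (hf : PolyTime f) : PolyTime fun γ => sameInner (V γ) (e γ) (f γ) := by
  unfold TCOKernel.sameInner
  fun_prop

variable {c : ℕ} {k : Γ → ℕ} {F : Γ → List (List α)}

@[fun_prop]
theorem PolyTime.core (hF : PolyTime F) : PolyTime fun γ => core c (F γ) := by
  unfold TCOKernel.core
  fun_prop

@[fun_prop]
theorem PolyTime.outerAuction (hF : PolyTime F) : PolyTime fun γ => outerAuction c (F γ) := by
  unfold TCOKernel.outerAuction
  exact PolyTime.auction (sL := fun γ => TCOKernel.sameOuter (TCOKernel.core c (F γ)))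
    (sR := fun γ => TCOKernel.sameInner (TCOKernel.core c (F γ)))
    (by fun_prop) (by fun_prop) (by fun_prop)

@[fun_prop]
theorem PolyTime.matched (hF : PolyTime F) : PolyTime fun γ => matched c (F γ) := by
  unfold TCOKernel.matched
  fun_prop

@[fun_prop]
theorem PolyTime.crown (hF : PolyTime F) : PolyTime fun γ => crown c (F γ) := by
  unfold TCOKernel.crown
  fun_prop

@[fun_prop]
theorem PolyTime.powConst {m : ℕ} (hk : PolyTime k) : PolyTime fun γ => k γ ^ m := by
  simpa using PolyTime.powSub (m := m) hk (PolyTime.const ([] : List ℕ))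

@[fun_prop]
theorem PolyTime.witness (hk : PolyTime k) (hF : PolyTime F) :
    PolyTime fun γ => witness c (k γ) (F γ) := by
  unfold TCOKernel.witness
  fun_prop

@[fun_prop]
theorem PolyTime.reduce (hk : PolyTime k) (hF : PolyTime F) :
    PolyTime fun γ => reduce c (k γ) (F γ) := by
  unfold TCOKernel.reduce
  fun_prop

end Kernel

/-! ### Members of reduced families -/

section Subfamilies

theorem sublist_of_mem_subl {α : Type} {n : ℕ} {l s : List α} (h : s ∈ subl n l) :
    s.Sublist l := by
  induction n generalizing l s with
  | zero =>
    rw [List.mem_singleton.1 h]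
    exact List.nil_sublist l
  | succ n ih =>
    rw [subl, List.mem_append] at h
    rcases h with h | h
    · exact (ih h).trans (List.tail_sublist l)
    · cases l with
      | nil => simp at h
      | cons a l =>
        simp only [List.take_succ_cons, List.take_zero, List.flatMap_cons, List.flatMap_nil,
          List.append_nil, List.mem_map, List.tail_cons] at h
        obtain ⟨t, ht, rfl⟩ := h
        exact (ih ht).cons_cons a

theorem nil_mem_subl {α : Type} {n : ℕ} {l : List α} : [] ∈ subl n l := by
  induction n generalizing l with
  | zero => simp [subl]
  | succ n ih => exact List.mem_append_left _ ih

theorem filter_mem_subl {α : Type} {n : ℕ} {l : List α} (p : α → Bool) (h : l.length ≤ n) :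
    l.filter p ∈ subl n l := by
  induction n generalizing l with
  | zero => rw [List.length_eq_zero_iff.1 (Nat.le_zero.1 h)]; simp [subl]
  | succ n ih =>
    cases l with
    | nil => exact List.mem_append_left _ (ih (l := []) (Nat.zero_le n))
    | cons a l =>
      have := ih (l := l) (by simpa using h)
      rw [subl, List.mem_append]
      cases hp : p a
      · left; simpa [hp] using this
      · right; simpa [hp] using this

variable {α : Type} [DecidableEq α] {c k : ℕ} {F Z : List (List α)} {S e : List α}

theorem subs_iff {l₁ l₂ : List α} : subs l₁ l₂ = true ↔ l₁ ⊆ l₂ := by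
  simp [subs, List.subset_def]

theorem mem_contract {P : List (List α)} :
    e ∈ contract P F ↔ e ∈ P ∨ e ∈ F ∧ ∀ S ∈ P, ¬ S ⊆ e := by
  simp [contract, ← subs_iff]

theorem mem_of_mem_matched (h : e ∈ matched c F) : e ∈ F ∧ ¬ e ⊆ core c F := by
  rw [matched, List.mem_map] at h
  obtain ⟨a, ha, rfl⟩ := h
  have h1 : a.1 ∈ (outerAuction c F).map Prod.fst :=
    List.mem_map_of_mem (List.mem_filter.1 ha).1
  rw [outerAuction, auction, map_fst_iterate_bid, List.map_map] at h1
  change _ ∈ List.map _root_.id _ at h1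
  rw [List.map_id, List.mem_filter] at h1
  rw [← subs_iff]
  simpa using h1

theorem weak_subset : weak c F ⊆ F := (greedy_sublist _ F).subset

theorem witness_subset : witness c k F ⊆ F := by
  intro e he
  unfold witness at he
  cases h : decide (k ^ (c - 1) < (weak c F).length) <;> rw [h] at he
  · exact (mem_of_mem_matched (weak_subset he)).1
  · exact weak_subset he

theorem exists_of_mem_heaviest (h : S ∈ heaviest c k Z) :
    S ∈ heavies c k Z ∧ ∀ S' ∈ heavies c k Z, S'.length ≤ S.length := by
  have h1 := (List.take_sublist _ _).subset h
  simpa using h1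

theorem mem_heavies : S ∈ heavies c k Z ↔ (∃ e ∈ Z, S ∈ subl c e) ∧
    k ^ (c - 1 - S.length) < (Z.filter fun e => subs S e).length := by
  simp [heavies, heavy]

theorem sublist_of_mem_heaviest (h : S ∈ heaviest c k (witness c k F)) :
    ∃ e ∈ F, S.Sublist e :=
  let ⟨e, he, hS⟩ := (mem_heavies.1 (exists_of_mem_heaviest h).1).1
  ⟨e, witness_subset he, sublist_of_mem_subl hS⟩

theorem length_heaviest_le : (heaviest c k Z).length ≤ 1 := by
  rw [heaviest, List.length_take]
  omega

/-- Every member of the reduced family is a sublist of a member of the original one. -/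
theorem sublist_of_mem_iterate_reduce {i : ℕ} (h : e ∈ (reduce c k)^[i] F) :
    ∃ f ∈ F, e.Sublist f := by
  induction i generalizing e with
  | zero => exact ⟨e, h, List.Sublist.refl e⟩
  | succ i ih =>
    rw [Function.iterate_succ_apply', reduce, mem_contract] at h
    rcases h with h | h
    · obtain ⟨f, hf, hef⟩ := sublist_of_mem_heaviest h
      obtain ⟨g, hg, hfg⟩ := ih hf
      exact ⟨g, hg, hef.trans hfg⟩
    · exact ih h.1

theorem length_iterate_reduce_le {i : ℕ} : ((reduce c k)^[i] F).length ≤ F.length + i := by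
  induction i with
  | zero => exact le_rfl
  | succ i ih =>
    rw [Function.iterate_succ_apply', reduce, contract, List.length_append]
    have h1 := length_heaviest_le (c := c) (k := k) (Z := witness c k ((reduce c k)^[i] F))
    have h2 := List.length_filter_le
      (fun e => (heaviest c k (witness c k ((reduce c k)^[i] F))).all fun S => !subs S e)
      ((reduce c k)^[i] F)
    omega

end Subfamilies

/-! ### Running time of the reduction -/

section Kernel

variable {Γ α : Type} [Enc Γ] [Enc α] [DecidableEq α] [PolyEq α]
variable {c : ℕ} {k : Γ → ℕ} {F : Γ → List (List α)}

@[fun_prop]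
theorem PolyTime.reduced (hk : PolyTime k) (hF : PolyTime F) :
    PolyTime fun γ => reduced c (k γ) (F γ) := by
  obtain ⟨S, hS⟩ := hF.esize_le
  unfold TCOKernel.reduced
  refine PolyTime.iterate (f := fun γ x => TCOKernel.reduce c (k γ) x) (by fun_prop)
    (by fun_prop) hF ⟨2 * S * (S + 1) + 1, fun γ i hi => ?_⟩
  simp only [Polynomial.eval_add, Polynomial.eval_mul, Polynomial.eval_one,
    Polynomial.eval_ofNat]
  have hlen := length_le_esize (F γ)
  have hSγ := hS γ
  refine esize_list_le (length_iterate_reduce_le.trans (by omega)) fun e he => ?_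
  obtain ⟨f, hf, hef⟩ := sublist_of_mem_iterate_reduce he
  exact (esize_sublist hef).trans ((esize_le_of_mem hf).le.trans hSγ)

@[fun_prop]
theorem PolyTime.kernelSets (hk : PolyTime k) (hF : PolyTime F) :
    PolyTime fun γ => kernelSets c (k γ) (F γ) := by
  unfold TCOKernel.kernelSets
  have hset : PolyTime fun x : Γ × List α × List α => TCOKernel.setEq x.2.1 x.2.2 := by fun_prop
  have h1 := PolyTime.greedy (r := fun _ => TCOKernel.setEq) hset hF
  have h2 := PolyTime.greedy (r := fun _ => TCOKernel.setEq) hset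
    (by fun_prop : PolyTime fun γ => TCOKernel.contract
      (TCOKernel.crown c (TCOKernel.reduced c (k γ) (F γ))) (TCOKernel.reduced c (k γ) (F γ)))
  fun_prop

end Kernel

/-! ### Maximality of greedy subfamilies -/

section Greedy

variable {α : Type} {r : α → α → Bool} {L : List α}

theorem greedy_pairwise : (greedy r L).Pairwise fun e f => r e f = false := by
  induction L with
  | nil => exact List.Pairwise.nil
  | cons e L ih =>
    rw [greedy_cons]
    cases h : (greedy r L).any (r e)
    · exact List.pairwise_cons.2 ⟨by simpa using h, ih⟩
    · exact ih

theorem greedy_maximal (hr : ∀ e, r e e = true) {e : α} (he : e ∈ L) :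
    ∃ f ∈ greedy r L, r e f = true := by
  induction L with
  | nil => simp at he
  | cons e' L ih =>
    rw [greedy_cons]
    rcases List.mem_cons.1 he with rfl | he
    · cases h : (greedy r L).any (r e)
      · exact ⟨e, List.mem_cons_self, hr e⟩
      · simpa using h
    · obtain ⟨f, hf, hef⟩ := ih he
      refine ⟨f, ?_, hef⟩
      cases (greedy r L).any (r e')
      · exact List.mem_cons_of_mem _ hf
      · exact hf

theorem length_le_of_nodup_of_subset {l₁ l₂ : List α} (hd : l₁.Nodup) (h : l₁ ⊆ l₂) :
    l₁.length ≤ l₂.length :=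
  (List.subperm_of_subset hd h).length_le

theorem length_filter_le_sum {β : Type} {X : Finset α}
    (p : β → Bool) (q : α → β → Bool) (L : List β)
    (h : ∀ e ∈ L, p e = true → ∃ x ∈ X, q x e = true) :
    (L.filter p).length ≤ ∑ x ∈ X, (L.filter (q x)).length := by
  induction L with
  | nil => simp
  | cons e L ih =>
    have h1 := ih fun f hf => h f (List.mem_cons_of_mem _ hf)
    have h2 : ∑ x ∈ X, ((e :: L).filter (q x)).length =
        ∑ x ∈ X, (L.filter (q x)).length + ∑ x ∈ X, (if q x e = true then 1 else 0) := by
      rw [← Finset.sum_add_distrib]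
      refine Finset.sum_congr rfl fun x _ => ?_
      rw [List.filter_cons]
      split <;> simp
    rw [h2, List.filter_cons]
    split
    · rename_i hpe
      obtain ⟨x, hx, hqx⟩ := h e List.mem_cons_self hpe
      have h3 : (if q x e = true then 1 else 0) ≤ ∑ x ∈ X, (if q x e = true then 1 else 0) :=
        Finset.single_le_sum (f := fun x => if q x e = true then 1 else 0)
          (fun _ _ => Nat.zero_le _) hx
      rw [if_pos hqx] at h3
      simp only [List.length_cons]
      omega
    · omega

end Greedy

/-! ### Reduction by heavy sets -/

section Reduction

variable {α : Type} [DecidableEq α] {c k : ℕ} {F Z : List (List α)} {S e f : List α}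
  {X : Finset α}

/-- `X` meets every member of `F`. -/
def Meets (X : Finset α) (F : List (List α)) : Prop := ∀ e ∈ F, ∃ a ∈ e, a ∈ X

/-- The members of `F` have at most `c` elements, listed without repetition. -/
def Bounded (c : ℕ) (F : List (List α)) : Prop := ∀ e ∈ F, e.Nodup ∧ e.length ≤ c

theorem Meets.of_contract {P : List (List α)} (h : Meets X (contract P F)) : Meets X F := by
  intro e he
  by_cases hP : ∃ S ∈ P, S ⊆ e
  · obtain ⟨S, hS, hSe⟩ := hP
    obtain ⟨a, ha, haX⟩ := h S (mem_contract.2 (.inl hS))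
    exact ⟨a, hSe ha, haX⟩
  · push Not at hP
    exact h e (mem_contract.2 (.inr ⟨he, hP⟩))

theorem conflict_self : conflict c e e = true := by
  simp [conflict, subs]

theorem conflict_eq_false (hc : 2 ≤ c) : conflict c e f = false ↔
    ¬ e ⊆ f ∧ (e.filter fun a => decide (a ∈ f)).length < c - 1 := by
  rw [conflict, Bool.or_eq_false_iff, ← Bool.not_eq_true, subs_iff, decide_eq_false_iff_not]
  refine and_congr_right fun _ => ?_
  omega

/-- The members of `Z` are pairwise weakly related: none contains another one, and any two of them
have fewer than `c - 1` elements in common. -/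
def WeaklyRelated (c : ℕ) (Z : List (List α)) : Prop :=
  Z.Pairwise fun e f => conflict c e f = false

theorem weaklyRelated_weak : WeaklyRelated c (weak c F) := greedy_pairwise

theorem weaklyRelated_witness : WeaklyRelated c (witness c k F) := by
  unfold witness
  cases decide (k ^ (c - 1) < (weak c F).length)
  · exact weaklyRelated_weak
  · exact weaklyRelated_weak

theorem WeaklyRelated.nodup (hZ : WeaklyRelated c Z) : Z.Nodup :=
  hZ.imp fun {e f} h hef => by rw [hef, conflict_self] at h; cases h

/-- At most one member of a weakly related family contains a given set of `c - 1` elements. -/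
theorem WeaklyRelated.length_filter_le_one (hc : 2 ≤ c) (hZ : WeaklyRelated c Z) (hS : S.Nodup)
    (hlen : c - 1 ≤ S.length) : (Z.filter fun e => subs S e).length ≤ 1 := by
  by_contra! h
  have hp := List.Pairwise.filter (fun e => subs S e) hZ
  have hall : ∀ e ∈ Z.filter fun e => subs S e, S ⊆ e := fun e he =>
    subs_iff.1 (List.mem_filter.1 he).2
  match hL : Z.filter fun e => subs S e with
  | [] => simp [hL] at h
  | [_] => simp [hL] at h
  | e :: f :: L =>
    rw [hL] at hp hall
    have h1 := ((conflict_eq_false hc).1 (List.pairwise_cons.1 hp |>.1 f List.mem_cons_self)).2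
    have h2 : S ⊆ e.filter fun a => decide (a ∈ f) := fun a ha =>
      List.mem_filter.2 ⟨hall e List.mem_cons_self ha,
        decide_eq_true (hall f (List.mem_cons_of_mem _ List.mem_cons_self) ha)⟩
    have := length_le_of_nodup_of_subset hS h2
    omega

/-- Every small set that meets all members of a weakly related family meets its heaviest heavy
sets `S`: otherwise the members that contain `S` are distributed among the few sets `S ∪ {x}`,
which are not heavy. -/
theorem meets_heaviest (hc : 2 ≤ c) (hZ : WeaklyRelated c Z) (hb : Bounded c Z)
    (hX : X.card ≤ k) (hit : Meets X Z) : Meets X (heaviest c k Z) := by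
  intro S hS
  obtain ⟨hS, hmax⟩ := exists_of_mem_heaviest hS
  obtain ⟨⟨e₀, he₀, hSe₀⟩, hheavy⟩ := mem_heavies.1 hS
  have hSd : S.Nodup := (hb e₀ he₀).1.sublist (sublist_of_mem_subl hSe₀)
  by_contra! hno
  rcases Nat.lt_or_ge S.length (c - 1) with hlt | hge
  -- A heavy set `x :: S` would, as a sublist of a member of `Z`, be a longer heavy sublist.
  · have hx : ∀ x ∈ X, (Z.filter fun e => subs (x :: S) e).length ≤
        k ^ (c - 1 - (S.length + 1)) := by
      intro x hx
      by_contra! hgt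
      obtain ⟨e, he⟩ := List.exists_mem_of_length_pos (Nat.zero_lt_of_lt hgt)
      obtain ⟨heZ, hxe⟩ := List.mem_filter.1 he
      rw [subs_iff] at hxe
      have hxS : x ∉ S := fun h => hno x h hx
      have hmem : ∀ a, a ∈ e.filter (fun a => decide (a ∈ x :: S)) ↔ a ∈ x :: S := by
        intro a
        rw [List.mem_filter, decide_eq_true_iff]
        exact ⟨And.right, fun h => ⟨hxe h, h⟩⟩
      have hperm : (e.filter fun a => decide (a ∈ x :: S)).Perm (x :: S) :=
        (List.perm_ext_iff_of_nodup ((hb e heZ).1.filter _)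
          (List.nodup_cons.2 ⟨hxS, hSd⟩)).2 hmem
      have hlen := hperm.length_eq
      rw [List.length_cons] at hlen
      have hsub : ∀ g, subs (e.filter fun a => decide (a ∈ x :: S)) g = subs (x :: S) g := by
        intro g
        rw [Bool.eq_iff_iff, subs_iff, subs_iff]
        exact ⟨List.Subset.trans hperm.symm.subset, List.Subset.trans hperm.subset⟩
      have hin : (e.filter fun a => decide (a ∈ x :: S)) ∈ heavies c k Z := by
        refine mem_heavies.2 ⟨⟨e, heZ, filter_mem_subl _ (hb e heZ).2⟩, ?_⟩
        simp only [hlen, hsub]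
        exact hgt
      have := hmax _ hin
      omega
    have hsum := length_filter_le_sum (X := X) (subs S) (fun x => subs (x :: S)) Z (by
      intro e he hSe
      obtain ⟨a, ha, haX⟩ := hit e he
      exact ⟨a, haX, subs_iff.2 (List.cons_subset.2 ⟨ha, subs_iff.1 hSe⟩)⟩)
    have h1 := hsum.trans (Finset.sum_le_card_nsmul X _ _ hx)
    have h2 : X.card • k ^ (c - 1 - (S.length + 1)) ≤ k ^ (c - 1 - S.length) := by
      rw [show c - 1 - S.length = c - 1 - (S.length + 1) + 1 by omega, pow_succ, smul_eq_mul,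
        mul_comm]
      gcongr
    exact absurd hheavy (not_lt.2 (h1.trans h2))
  · have := hZ.length_filter_le_one hc hSd hge
    rw [Nat.sub_eq_zero_of_le hge, pow_zero] at hheavy
    omega

theorem meets_reduce (hc : 2 ≤ c) (hb : Bounded c F) (hX : X.card ≤ k) (hit : Meets X F) :
    Meets X (reduce c k F) := by
  intro e he
  rcases mem_contract.1 he with h | h
  · exact meets_heaviest hc weaklyRelated_witness (fun f hf => hb f (witness_subset hf)) hX
      (fun f hf => hit f (witness_subset hf)) e h
  · exact hit e h.1

theorem bounded_iterate_reduce (hb : Bounded c F) (i : ℕ) : Bounded c ((reduce c k)^[i] F) := by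
  intro e he
  obtain ⟨f, hf, hef⟩ := sublist_of_mem_iterate_reduce he
  exact ⟨(hb f hf).1.sublist hef, hef.length_le.trans (hb f hf).2⟩

theorem meets_reduced (hc : 2 ≤ c) (hb : Bounded c F) (hX : X.card ≤ k) (hit : Meets X F) :
    Meets X (reduced c k F) := by
  unfold reduced
  induction F.length with
  | zero => exact hit
  | succ i ih =>
    rw [Function.iterate_succ_apply']
    exact meets_reduce hc (bounded_iterate_reduce hb i) hX ih

theorem Meets.of_reduced (h : Meets X (reduced c k F)) : Meets X F := by
  unfold reduced at h
  revert h
  induction F.length with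
  | zero => exact id
  | succ i ih =>
    rw [Function.iterate_succ_apply']
    exact fun h => ih h.of_contract

/-- Iterating a map that decreases `μ` wherever it is not the identity leads to a fixed point. -/
theorem iterate_measure_fixed {β : Type} {g : β → β} (P : β → Prop) (μ : β → ℕ)
    (hP : ∀ x, P x → P (g x)) (h : ∀ x, P x → g x = x ∨ μ (g x) < μ x) {n : ℕ} {x : β}
    (hx : P x) (hn : μ x ≤ n) : g (g^[n] x) = g^[n] x := by
  induction n generalizing x with
  | zero => exact (h x hx).resolve_right (by omega)
  | succ n ih =>
    rw [Function.iterate_succ_apply]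
    rcases h x hx with hx' | hx'
    · rw [hx', Function.iterate_fixed hx', hx']
    · exact ih (hP x hx) (by omega)

theorem length_reduce_lt (hk : k ≠ 0) (h : heaviest c k (witness c k F) ≠ []) :
    (reduce c k F).length < F.length := by
  have hle := length_heaviest_le (c := c) (k := k) (Z := witness c k F)
  obtain ⟨S, hS⟩ : ∃ S, heaviest c k (witness c k F) = [S] := by
    match hh : heaviest c k (witness c k F) with
    | [] => exact absurd hh h
    | [S] => exact ⟨S, rfl⟩
    | _ :: _ :: _ => simp [hh] at hle
  have hmem : S ∈ heaviest c k (witness c k F) := hS ▸ List.mem_singleton_self S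
  have hheavy := (mem_heavies.1 (exists_of_mem_heaviest hmem).1).2
  have hpos : 0 < k ^ (c - 1 - S.length) := pow_pos (Nat.pos_of_ne_zero hk) _
  have hnd := (weaklyRelated_witness (c := c) (k := k) (F := F)).nodup.filter fun e => subs S e
  have hcount := length_le_of_nodup_of_subset hnd
    (l₂ := F.filter fun e => subs S e) fun e he => by
      obtain ⟨h1, h2⟩ := List.mem_filter.1 he
      exact List.mem_filter.2 ⟨witness_subset h1, h2⟩
  have hsplit := List.length_eq_length_filter_add (l := F) fun e => subs S e
  rw [reduce, hS, contract, List.length_append]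
  simp only [List.all_cons, List.all_nil, Bool.and_true, List.length_singleton]
  omega

theorem reduce_reduced (hk : k ≠ 0) : reduce c k (reduced c k F) = reduced c k F := by
  refine iterate_measure_fixed (fun _ => True) List.length (fun _ _ => trivial) (fun G _ => ?_)
    trivial le_rfl
  by_cases h : heaviest c k (witness c k G) = []
  · left
    simp [reduce, h, contract]
  · exact .inr (length_reduce_lt hk h)

theorem length_witness_reduced_le (hk : k ≠ 0) :
    (witness c k (reduced c k F)).length ≤ k ^ (c - 1) := by
  set G := reduced c k F with hG
  have h1 : heaviest c k (witness c k G) = [] := by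
    by_contra h
    have := length_reduce_lt hk h
    rw [reduce_reduced hk] at this
    exact lt_irrefl _ this
  have h2 : heavies c k (witness c k G) = [] := by
    by_contra h
    obtain ⟨S, hS, hmax⟩ := (heavies c k (witness c k G)).toFinset.exists_max_image List.length
      (by rwa [List.toFinset_nonempty_iff])
    have hS' : S ∈ (heavies c k (witness c k G)).filter fun S =>
        (heavies c k (witness c k G)).all fun S' => !decide (S.length < S'.length) := by
      simp only [List.mem_toFinset] at hS hmax
      simpa using ⟨hS, hmax⟩
    rw [heaviest, List.take_eq_nil_iff] at h1
    simp only [one_ne_zero, false_or] at h1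
    rw [h1] at hS'
    cases hS'
  by_contra! h
  obtain ⟨e, he⟩ := List.exists_mem_of_length_pos (Nat.zero_lt_of_lt h)
  have : [] ∈ heavies c k (witness c k G) :=
    mem_heavies.2 ⟨⟨e, he, nil_mem_subl⟩, by simpa [subs] using h⟩
  rw [h2] at this
  cases this

/-- In the reduced family not even the empty set is heavy, so both weakly related families are
small. -/
theorem length_weak_reduced_le (hk : k ≠ 0) :
    (weak c (reduced c k F)).length ≤ k ^ (c - 1) ∧
      (weak c (matched c (reduced c k F))).length ≤ k ^ (c - 1) := by
  have h := length_witness_reduced_le (c := c) (F := F) hk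
  unfold witness at h
  cases h' : decide (k ^ (c - 1) < (weak c (reduced c k F)).length) <;> rw [h'] at h
  · exact ⟨not_lt.1 (of_decide_eq_false h'), h⟩
  · exact absurd h (not_le.2 (of_decide_eq_true h'))

end Reduction

/-! ### Correctness of the auction -/

section Auction

variable {ε A B : Type} {sL sR : ε → ε → Bool} {E : List ε} {lft : ε → A} {rgt : ε → B}
  {st : List (ε × ℕ × Bool)} {N : ℕ}

/-- The invariants of the auction in the bipartite graph with edge list `E`, where `lft` and `rgt`
give the ends of an edge: prices belong to right ends and are bounded by `N`; the flagged edges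
match left with right ends one to one; right ends with a positive price are matched; and a matched
left end is content, i.e. its right end costs at most one more than any other right end that is
adjacent to it. -/
structure AuctionInv (E : List ε) (lft : ε → A) (rgt : ε → B) (N : ℕ)
    (st : List (ε × ℕ × Bool)) : Prop where
  fst : st.map Prod.fst = E
  price_le : ∀ a ∈ st, a.2.1 ≤ N
  price_eq : ∀ a ∈ st, ∀ b ∈ st, rgt a.1 = rgt b.1 → a.2.1 = b.2.1
  lft_eq : ∀ a ∈ st, ∀ b ∈ st, a.2.2 = true → b.2.2 = true → rgt a.1 = rgt b.1 → lft a.1 = lft b.1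
  rgt_eq : ∀ a ∈ st, ∀ b ∈ st, a.2.2 = true → b.2.2 = true → lft a.1 = lft b.1 → rgt a.1 = rgt b.1
  exists_matched : ∀ a ∈ st, 0 < a.2.1 → ∃ b ∈ st, b.2.2 = true ∧ rgt b.1 = rgt a.1
  content : ∀ a ∈ st, ∀ b ∈ st, a.2.2 = true → lft b.1 = lft a.1 → a.2.1 ≤ b.2.1 + 1

theorem auctionInv_init : AuctionInv E lft rgt N (E.map fun e => (e, 0, false)) where
  fst := by
    rw [List.map_map]
    exact List.map_id E
  price_le := by simp
  price_eq := by simp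
  lft_eq := by simp
  rgt_eq := by simp
  exists_matched := by simp
  content := by simp

theorem AuctionInv.mem (h : AuctionInv E lft rgt N st) {a : ε × ℕ × Bool} (ha : a ∈ st) :
    a.1 ∈ E :=
  h.fst ▸ List.mem_map_of_mem ha

theorem AuctionInv.mem_bidders (h : AuctionInv E lft rgt N st)
    (hL : ∀ e ∈ E, ∀ f ∈ E, sL e f = true ↔ lft e = lft f) {a : ε × ℕ × Bool} :
    a ∈ bidders sL N st ↔ a ∈ st ∧ a.2.1 < N ∧
      (∀ b ∈ st, b.2.2 = true → lft b.1 ≠ lft a.1) ∧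
      ∀ b ∈ st, lft a.1 = lft b.1 → a.2.1 ≤ b.2.1 := by
  rw [bidders, List.mem_filter]
  refine and_congr_right fun ha => ?_
  simp only [Bool.and_eq_true, decide_eq_true_eq, Bool.not_eq_true', List.any_eq_false,
    List.all_eq_true, Bool.and_eq_false_iff, decide_eq_false_iff_not, not_lt, and_assoc]
  refine and_congr_right fun _ => and_congr ?_ ?_
  · refine forall₂_congr fun b hb => ?_
    rw [hL _ (h.mem hb) _ (h.mem ha), not_and]
  · refine forall₂_congr fun b hb => ?_
    rw [← Bool.not_eq_true, hL _ (h.mem ha) _ (h.mem hb), imp_iff_not_or]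

theorem bid_of_bidders_eq_nil (hB : bidders sL N st = []) : bid sL sR N st = st := by
  simp [bid, hB]

/-- A bid preserves the invariants and decreases the sum of the distances of the prices to `N`. -/
theorem AuctionInv.bid_step (h : AuctionInv E lft rgt N st)
    (hL : ∀ e ∈ E, ∀ f ∈ E, sL e f = true ↔ lft e = lft f)
    (hR : ∀ e ∈ E, ∀ f ∈ E, sR e f = true ↔ rgt e = rgt f)
    (hB : bidders sL N st ≠ []) :
    AuctionInv E lft rgt N (bid sL sR N st) ∧
      ((bid sL sR N st).map fun a => N - a.2.1).sum < (st.map fun a => N - a.2.1).sum := by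
  classical
  obtain ⟨a₀, l, hl⟩ := List.exists_cons_of_ne_nil hB
  obtain ⟨ha₀, hlt, hfree, hmin⟩ := (h.mem_bidders hL).1 (hl ▸ List.mem_cons_self : a₀ ∈ _)
  have hbid : bid sL sR N st = st.map fun b => if rgt a₀.1 = rgt b.1
      then (b.1, b.2.1 + 1, decide (lft a₀.1 = lft b.1)) else b := by
    rw [bid, hl]
    refine List.map_congr_left fun b hb => ?_
    have e1 : sL a₀.1 b.1 = decide (lft a₀.1 = lft b.1) := by
      rw [Bool.eq_iff_iff, hL _ (h.mem ha₀) _ (h.mem hb), decide_eq_true_iff]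
    have e2 := hR _ (h.mem ha₀) _ (h.mem hb)
    simp only [List.take_succ_cons, List.take_zero, List.any_cons, List.any_nil, Bool.or_false, e1]
    by_cases hr : rgt a₀.1 = rgt b.1
    · rw [if_pos hr, e2.2 hr, cond_true]
    · rw [if_neg hr, Bool.eq_false_iff.2 (mt e2.1 hr), cond_false]
  have hmem : ∀ b' ∈ bid sL sR N st, ∃ b ∈ st, b'.1 = b.1 ∧
      (rgt a₀.1 = rgt b.1 ∧ b'.2.1 = b.2.1 + 1 ∧ (b'.2.2 = true ↔ lft a₀.1 = lft b.1) ∨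
        rgt a₀.1 ≠ rgt b.1 ∧ b'.2.1 = b.2.1 ∧ b'.2.2 = b.2.2) := by
    intro b' hb'
    rw [hbid] at hb'
    obtain ⟨b, hb, rfl⟩ := List.mem_map.1 hb'
    refine ⟨b, hb, ?_⟩
    by_cases hr : rgt a₀.1 = rgt b.1 <;> simp [hr]
  have hmem' : ∀ b ∈ st, (if rgt a₀.1 = rgt b.1
      then (b.1, b.2.1 + 1, decide (lft a₀.1 = lft b.1)) else b) ∈ bid sL sR N st := by
    intro b hb
    rw [hbid]
    exact List.mem_map_of_mem hb
  refine ⟨⟨?_, ?_, ?_, ?_, ?_, ?_, ?_⟩, ?_⟩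
  · rw [map_fst_bid, h.fst]
  · intro a' ha'
    obtain ⟨a, ha, -, ⟨hr, hp, -⟩ | ⟨-, hp, -⟩⟩ := hmem a' ha'
    · have := h.price_eq _ ha₀ _ ha hr
      omega
    · exact hp ▸ h.price_le a ha
  · intro a' ha' b' hb' hab
    obtain ⟨a, ha, hae, ha2⟩ := hmem a' ha'
    obtain ⟨b, hb, hbe, hb2⟩ := hmem b' hb'
    rw [hae, hbe] at hab
    have := h.price_eq a ha b hb hab
    rw [hab] at ha2
    rcases ha2 with ⟨h1, h2, -⟩ | ⟨h1, h2, -⟩ <;> rcases hb2 with ⟨h3, h4, -⟩ | ⟨h3, h4, -⟩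
    · omega
    · exact absurd h1 h3
    · exact absurd h3 h1
    · omega
  · intro a' ha' b' hb' hfa hfb hab
    obtain ⟨a, ha, hae, ha2⟩ := hmem a' ha'
    obtain ⟨b, hb, hbe, hb2⟩ := hmem b' hb'
    rw [hae, hbe] at hab ⊢
    rw [hab] at ha2
    rcases ha2 with ⟨h1, -, h2⟩ | ⟨h1, -, h2⟩ <;> rcases hb2 with ⟨h3, -, h4⟩ | ⟨h3, -, h4⟩
    · exact (h2.1 hfa).symm.trans (h4.1 hfb)
    · exact absurd h1 h3
    · exact absurd h3 h1
    · exact h.lft_eq a ha b hb (h2 ▸ hfa) (h4 ▸ hfb) hab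
  · intro a' ha' b' hb' hfa hfb hab
    obtain ⟨a, ha, hae, ha2⟩ := hmem a' ha'
    obtain ⟨b, hb, hbe, hb2⟩ := hmem b' hb'
    rw [hae, hbe] at hab ⊢
    rcases ha2 with ⟨h1, -, h2⟩ | ⟨h1, -, h2⟩ <;> rcases hb2 with ⟨h3, -, h4⟩ | ⟨h3, -, h4⟩
    · exact h1.symm.trans h3
    · exact absurd (hab.symm.trans (h2.1 hfa).symm) (hfree b hb (h4 ▸ hfb))
    · exact absurd (hab.trans (h4.1 hfb).symm) (hfree a ha (h2 ▸ hfa))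
    · exact h.rgt_eq a ha b hb (h2 ▸ hfa) (h4 ▸ hfb) hab
  · intro a' ha' hpos
    obtain ⟨a, ha, hae, ⟨h1, -, -⟩ | ⟨h1, h2, -⟩⟩ := hmem a' ha'
    · have := hmem' a₀ ha₀
      rw [if_pos rfl] at this
      exact ⟨_, this, decide_eq_true rfl, by rw [hae, h1]⟩
    · obtain ⟨b, hb, hfb, hba⟩ := h.exists_matched a ha (h2 ▸ hpos)
      have := hmem' b hb
      rw [if_neg (hba ▸ h1)] at this
      exact ⟨b, this, hfb, by rw [hae, hba]⟩
  · intro a' ha' b' hb' hfa hab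
    obtain ⟨a, ha, hae, ha2⟩ := hmem a' ha'
    obtain ⟨b, hb, hbe, hb2⟩ := hmem b' hb'
    rw [hae, hbe] at hab
    have hbp : b.2.1 ≤ b'.2.1 := by
      rcases hb2 with ⟨-, h3, -⟩ | ⟨-, h3, -⟩ <;> omega
    rcases ha2 with ⟨h1, h2, h3⟩ | ⟨h1, h2, h3⟩
    · have e1 := hmin b hb ((h3.1 hfa).trans hab.symm)
      have e2 := h.price_eq _ ha₀ _ ha h1
      omega
    · have := h.content a ha b hb (h3 ▸ hfa) hab
      omega
  · rw [hbid, List.map_map]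
    refine List.sum_lt_sum _ _ (fun b _ => ?_) ⟨a₀, ha₀, ?_⟩
    · by_cases hr : rgt a₀.1 = rgt b.1
      · simp only [Function.comp_apply, if_pos hr]
        omega
      · simp [hr]
    · simp only [Function.comp_apply, if_true]
      omega

/-- The outcome of the auction satisfies the invariants, and no bidders are left. -/
theorem auction_spec (E : List ε) (lft : ε → A) (rgt : ε → B)
    (hL : ∀ e ∈ E, ∀ f ∈ E, sL e f = true ↔ lft e = lft f)
    (hR : ∀ e ∈ E, ∀ f ∈ E, sR e f = true ↔ rgt e = rgt f) :
    AuctionInv E lft rgt (E.length + 1) (auction sL sR E) ∧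
      bidders sL (E.length + 1) (auction sL sR E) = [] := by
  have hinv : ∀ st, AuctionInv E lft rgt (E.length + 1) st →
      AuctionInv E lft rgt (E.length + 1) (bid sL sR (E.length + 1) st) := by
    intro st h
    by_cases hB : bidders sL (E.length + 1) st = []
    · rwa [bid_of_bidders_eq_nil hB]
    · exact (h.bid_step hL hR hB).1
  have hI : AuctionInv E lft rgt (E.length + 1) (auction sL sR E) := by
    unfold auction
    induction E.length * (E.length + 1) with
    | zero => exact auctionInv_init
    | succ i ih =>
      rw [Function.iterate_succ_apply']
      exact hinv _ ih
  refine ⟨hI, ?_⟩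
  by_contra hB
  have hlt := (hI.bid_step hL hR hB).2
  have hfix : bid sL sR (E.length + 1) (auction sL sR E) = auction sL sR E := by
    refine iterate_measure_fixed (AuctionInv E lft rgt (E.length + 1))
      (fun st => (st.map fun a => E.length + 1 - a.2.1).sum) hinv (fun st h => ?_)
      auctionInv_init ?_
    · by_cases hB : bidders sL (E.length + 1) st = []
      · exact .inl (bid_of_bidders_eq_nil hB)
      · exact .inr (h.bid_step hL hR hB).2
    · simp [List.map_map, Function.comp_def]
  rw [hfix] at hlt
  exact lt_irrefl _ hlt

theorem mem_aboveGap {a : ε × ℕ × Bool} : a ∈ aboveGap N st ↔ a ∈ st ∧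
    ∃ g < N, 0 < g ∧ g < a.2.1 ∧ ∀ b ∈ st, b.2.1 ≠ g := by
  simp [aboveGap, and_assoc]

theorem AuctionInv.exists_matched_aboveGap (h : AuctionInv E lft rgt N st)
    {a : ε × ℕ × Bool} (ha : a ∈ aboveGap N st) :
    ∃ b ∈ aboveGap N st, b.2.2 = true ∧ rgt b.1 = rgt a.1 := by
  obtain ⟨ha, g, hgN, hg, hga, hgap⟩ := mem_aboveGap.1 ha
  obtain ⟨b, hb, hfb, hba⟩ := h.exists_matched a ha (by omega)
  exact ⟨b, mem_aboveGap.2 ⟨hb, g, hgN, hg, h.price_eq b hb a ha hba ▸ hga, hgap⟩, hfb, hba⟩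

/-- Content left ends that are matched above a gap have all their edges above this gap. -/
theorem AuctionInv.aboveGap_closed (h : AuctionInv E lft rgt N st) {a b : ε × ℕ × Bool}
    (ha : a ∈ aboveGap N st) (hfa : a.2.2 = true) (hb : b ∈ st) (hab : lft b.1 = lft a.1) :
    b ∈ aboveGap N st := by
  obtain ⟨ha, g, hgN, hg, hga, hgap⟩ := mem_aboveGap.1 ha
  have h1 := h.content a ha b hb hfa hab
  have h2 := hgap b hb
  exact mem_aboveGap.2 ⟨hb, g, hgN, hg, by omega, hgap⟩

/-- An unmatched left end has no cheap edges left, so by the pigeonhole principle there is a gap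
below the price of each of its edges. -/
theorem AuctionInv.aboveGap_of_unmatched (h : AuctionInv E lft rgt (E.length + 1) st)
    (hL : ∀ e ∈ E, ∀ f ∈ E, sL e f = true ↔ lft e = lft f)
    (hB : bidders sL (E.length + 1) st = []) {a : ε × ℕ × Bool} (ha : a ∈ st)
    (hun : ∀ b ∈ st, b.2.2 = true → lft b.1 ≠ lft a.1) : a ∈ aboveGap (E.length + 1) st := by
  have hprice : E.length + 1 ≤ a.2.1 := by
    induction hp : a.2.1 using Nat.strong_induction_on generalizing a with
    | _ p ih =>
      by_contra! hlt
      have : a ∉ bidders sL (E.length + 1) st := hB ▸ List.not_mem_nil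
      rw [h.mem_bidders hL] at this
      push Not at this
      obtain ⟨b, hb, hab, hba⟩ := this ha (hp ▸ hlt) hun
      have := ih _ (hp ▸ hba) hb (fun c hc hfc => hab ▸ hun c hc hfc) rfl
      omega
  -- Without a gap, all the `E.length + 1` numbers from `1` to `E.length + 1` are prices.
  have hlen : st.length = E.length := by rw [← h.fst, List.length_map]
  by_contra hno
  have hsub : Finset.Icc 1 (E.length + 1) ⊆ (st.map fun b => b.2.1).toFinset := by
    intro g hg
    rw [Finset.mem_Icc] at hg
    rw [List.mem_toFinset, List.mem_map]
    by_contra! hgap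
    refine hno (mem_aboveGap.2 ⟨ha, g, ?_, hg.1, ?_, hgap⟩)
    · have := hgap a ha
      have := h.price_le a ha
      omega
    · have := hgap a ha
      omega
  have h1 := Finset.card_le_card hsub
  have h2 := List.toFinset_card_le (st.map fun b => b.2.1)
  rw [Nat.card_Icc, Nat.add_sub_cancel] at h1
  rw [List.length_map] at h2
  omega

end Auction

/-! ### Crown reduction -/

section Crown

variable {α : Type} [DecidableEq α] {c k : ℕ} {G F : List (List α)} {e f : List α}
  {X : Finset α}

theorem mem_outer {V : List α} {a : α} : a ∈ outer V e ↔ a ∈ e ∧ a ∉ V := by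
  simp [outer]

theorem mem_inner {V : List α} {a : α} : a ∈ inner V e ↔ a ∈ e ∧ a ∈ V := by
  simp [inner]

theorem length_inner_add_length_outer (V e : List α) :
    (inner V e).length + (outer V e).length = e.length :=
  (List.length_eq_length_filter_add fun a => decide (a ∈ V)).symm

/-- By maximality of the weakly related family, a set that is not contained in the core has exactly
one element outside the core and `c - 1` elements inside. -/
theorem outer_inner_spec (hc : 2 ≤ c) (hb : Bounded c G) (he : e ∈ G) (hV : ¬ e ⊆ core c G) :
    (∃ x, outer (core c G) e = [x]) ∧ (inner (core c G) e).length = c - 1 := by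
  obtain ⟨f, hf, hef⟩ := greedy_maximal (r := conflict c) (fun _ => conflict_self) he
  have hfV : f ⊆ core c G := fun a ha => List.mem_flatten.2 ⟨f, hf, ha⟩
  rw [conflict, Bool.or_eq_true, subs_iff, decide_eq_true_iff] at hef
  have h1 := hef.resolve_left fun h => hV (List.Subset.trans h hfV)
  have h2 : (e.filter fun a => decide (a ∈ f)).length ≤ (inner (core c G) e).length :=
    (List.monotone_filter_right e fun a ha =>
      decide_eq_true (hfV (of_decide_eq_true ha))).length_le
  have h3 := length_inner_add_length_outer (core c G) e
  have h4 := (hb e he).2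
  have h5 : 0 < (outer (core c G) e).length := by
    rw [List.length_pos_iff_exists_mem]
    by_contra! h
    refine hV fun a ha => ?_
    by_contra haV
    exact h a (mem_outer.2 ⟨ha, haV⟩)
  exact ⟨List.length_eq_one_iff.1 (by omega), by omega⟩

theorem mem_outsiders : e ∈ G.filter (fun e => !subs e (core c G)) ↔ e ∈ G ∧ ¬ e ⊆ core c G := by
  rw [List.mem_filter, Bool.not_eq_true', ← Bool.not_eq_true, subs_iff]

theorem sameOuter_iff (hc : 2 ≤ c) (hb : Bounded c G) :
    ∀ e ∈ G.filter (fun e => !subs e (core c G)), ∀ f ∈ G.filter (fun e => !subs e (core c G)),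
      sameOuter (core c G) e f = true ↔ outer (core c G) e = outer (core c G) f := by
  intro e he f hf
  rw [mem_outsiders] at he hf
  obtain ⟨x, hx⟩ := (outer_inner_spec hc hb he.1 he.2).1
  obtain ⟨y, hy⟩ := (outer_inner_spec hc hb hf.1 hf.2).1
  have hxV : x ∉ core c G := (mem_outer.1 (hx ▸ List.mem_singleton_self x : x ∈ outer _ e)).2
  rw [sameOuter, subs_iff, hx, List.cons_subset, and_iff_left (List.nil_subset f)]
  constructor
  · intro h
    have : x ∈ outer (core c G) f := mem_outer.2 ⟨h, hxV⟩
    rw [hy, List.mem_singleton] at this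
    rw [hy, this]
  · intro h
    exact (mem_outer.1 (h ▸ List.mem_singleton_self x : x ∈ outer _ f)).1

theorem card_toFinset_inner (hc : 2 ≤ c) (hb : Bounded c G) (he : e ∈ G)
    (hV : ¬ e ⊆ core c G) : (inner (core c G) e).toFinset.card = c - 1 := by
  have hnd : (inner (core c G) e).Nodup := (hb e he).1.filter _
  rw [List.toFinset_card_of_nodup hnd]
  exact (outer_inner_spec hc hb he hV).2

theorem sameInner_iff (hc : 2 ≤ c) (hb : Bounded c G) :
    ∀ e ∈ G.filter (fun e => !subs e (core c G)), ∀ f ∈ G.filter (fun e => !subs e (core c G)),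
      sameInner (core c G) e f = true ↔
        (inner (core c G) e).toFinset = (inner (core c G) f).toFinset := by
  intro e he f hf
  rw [mem_outsiders] at he hf
  rw [sameInner, subs_iff]
  constructor
  · intro h
    refine Finset.eq_of_subset_of_card_le (fun a ha => ?_) ?_
    · rw [List.mem_toFinset] at *
      exact mem_inner.2 ⟨h ha, (mem_inner.1 ha).2⟩
    · rw [card_toFinset_inner hc hb he.1 he.2, card_toFinset_inner hc hb hf.1 hf.2]
  · intro h a ha
    rw [← List.mem_toFinset, h, List.mem_toFinset] at ha
    exact (mem_inner.1 ha).1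

theorem outerAuction_spec (hc : 2 ≤ c) (hb : Bounded c G) :
    AuctionInv (G.filter fun e => !subs e (core c G)) (outer (core c G))
      (fun e => (inner (core c G) e).toFinset)
      ((G.filter fun e => !subs e (core c G)).length + 1) (outerAuction c G) ∧
      bidders (sameOuter (core c G)) ((G.filter fun e => !subs e (core c G)).length + 1)
        (outerAuction c G) = [] :=
  auction_spec _ _ _ (sameOuter_iff hc hb) (sameInner_iff hc hb)

theorem mem_crown {S : List α} : S ∈ crown c G ↔
    ∃ a ∈ aboveGap ((G.filter fun e => !subs e (core c G)).length + 1) (outerAuction c G),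
      inner (core c G) a.1 = S :=
  List.mem_map

/-- Crown reduction: in a set that meets `G`, every element matched to a crown set `S` may be
exchanged for an element of `S`. -/
theorem exists_meets_contract_crown (hc : 2 ≤ c) (hb : Bounded c G) (hX : X.card ≤ k)
    (hit : Meets X G) : ∃ X' : Finset α, X'.card ≤ k ∧ Meets X' (contract (crown c G) G) := by
  classical
  obtain ⟨hI, -⟩ := outerAuction_spec hc hb
  set N := (G.filter fun e => !subs e (core c G)).length + 1
  set V := core c G with hVdef
  have hst : ∀ a ∈ aboveGap N (outerAuction c G),
      a ∈ outerAuction c G ∧ a.1 ∈ G ∧ ¬ a.1 ⊆ V := fun a ha =>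
    ⟨(mem_aboveGap.1 ha).1, mem_outsiders.1 (hI.mem (mem_aboveGap.1 ha).1)⟩
  -- The exchange map sends `x` to an element of a crown set with partner `x`, if there is one.
  have hφ : ∀ x, ∃ y, ((∃ a ∈ aboveGap N (outerAuction c G), a.2.2 = true ∧ outer V a.1 = [x]) →
      ∃ a ∈ aboveGap N (outerAuction c G), a.2.2 = true ∧ outer V a.1 = [x] ∧ y ∈ inner V a.1) ∧
      ((¬ ∃ a ∈ aboveGap N (outerAuction c G), a.2.2 = true ∧ outer V a.1 = [x]) → y = x) := by
    intro x
    by_cases h : ∃ a ∈ aboveGap N (outerAuction c G), a.2.2 = true ∧ outer V a.1 = [x]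
    · obtain ⟨a, ha, hfa, hax⟩ := h
      have hlen := (outer_inner_spec hc hb (hst a ha).2.1 (hst a ha).2.2).2
      obtain ⟨y, hy⟩ := List.exists_mem_of_length_pos (l := inner V a.1)
        (hlen ▸ (by omega : 0 < c - 1))
      exact ⟨y, fun _ => ⟨a, ha, hfa, hax, hy⟩, fun h => absurd ⟨a, ha, hfa, hax⟩ h⟩
    · exact ⟨x, fun h' => absurd h' h, fun _ => rfl⟩
  choose φ hφ1 hφ2 using hφ
  refine ⟨X.image φ, Finset.card_image_le.trans hX, fun S hS => ?_⟩
  rcases mem_contract.1 hS with hS | ⟨heG, hno⟩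
  · obtain ⟨a, ha, rfl⟩ := mem_crown.1 hS
    obtain ⟨b, hb', hfb, hba⟩ := hI.exists_matched_aboveGap ha
    obtain ⟨hbst, hbG, hbV⟩ := hst b hb'
    obtain ⟨y, hyb, hyX⟩ := hit b.1 hbG
    refine ⟨φ y, ?_, Finset.mem_image_of_mem φ hyX⟩
    change φ y ∈ inner V a.1
    rw [← List.mem_toFinset, ← hba, List.mem_toFinset]
    by_cases hyV : y ∈ V
    · rw [hφ2 y fun ⟨a', _, _, h⟩ =>
        (mem_outer.1 (h ▸ List.mem_singleton_self y : y ∈ outer V a'.1)).2 hyV]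
      exact mem_inner.2 ⟨hyb, hyV⟩
    · obtain ⟨x, hx⟩ := (outer_inner_spec hc hb hbG hbV).1
      have hyx : y ∈ outer V b.1 := mem_outer.2 ⟨hyb, hyV⟩
      rw [hVdef, hx, List.mem_singleton] at hyx
      subst hyx
      obtain ⟨a', ha', hfa', hay, hmem⟩ := hφ1 y ⟨b, hb', hfb, hx⟩
      have := hI.rgt_eq a' (hst a' ha').1 b hbst hfa' hfb (hay.trans hx.symm)
      rwa [← List.mem_toFinset, ← this, List.mem_toFinset]
  · obtain ⟨y, hyS, hyX⟩ := hit S heG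
    refine ⟨φ y, ?_, Finset.mem_image_of_mem φ hyX⟩
    rwa [hφ2 y]
    rintro ⟨a, ha, hfa, hay⟩
    have hyV : y ∉ V := (mem_outer.1 (hay ▸ List.mem_singleton_self y : y ∈ outer V a.1)).2
    have hSV : ¬ S ⊆ V := fun h => hyV (h hyS)
    obtain ⟨x, hx⟩ := (outer_inner_spec hc hb heG hSV).1
    have hyx : y ∈ outer V S := mem_outer.2 ⟨hyS, hyV⟩
    rw [hVdef, hx, List.mem_singleton] at hyx
    subst hyx
    have hSE : S ∈ (outerAuction c G).map Prod.fst := hI.fst ▸ mem_outsiders.2 ⟨heG, hSV⟩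
    obtain ⟨b, hbst, rfl⟩ := List.mem_map.1 hSE
    have hbA := hI.aboveGap_closed ha hfa hbst (hx.trans hay.symm)
    exact hno _ (mem_crown.2 ⟨b, hbA, rfl⟩) fun a h => (mem_inner.1 h).1

theorem mem_matched : e ∈ matched c G ↔ ∃ a ∈ outerAuction c G, a.2.2 = true ∧ a.1 = e := by
  simp [matched]

/-- After the crown reduction only matched elements are left outside the core, and each of them
is the outer element of a member of the weakly related family made from the matching. -/
theorem mem_core_or_mem_outer (hc : 2 ≤ c) (hb : Bounded c G)
    (he : e ∈ contract (crown c G) G) {a : α} (ha : a ∈ e) :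
    a ∈ core c G ++ (weak c (matched c G)).flatMap (outer (core c G)) := by
  obtain ⟨hI, hB⟩ := outerAuction_spec hc hb
  rw [List.mem_append, List.mem_flatMap]
  by_cases haV : a ∈ core c G
  · exact .inl haV
  right
  rcases mem_contract.1 he with h | ⟨heG, hno⟩
  · obtain ⟨b, -, rfl⟩ := mem_crown.1 h
    exact absurd (mem_inner.1 ha).2 haV
  have heV : ¬ e ⊆ core c G := fun h => haV (h ha)
  have heE : e ∈ (outerAuction c G).map Prod.fst := hI.fst ▸ mem_outsiders.2 ⟨heG, heV⟩
  obtain ⟨b, hbst, rfl⟩ := List.mem_map.1 heE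
  have hmatch : ∃ m ∈ outerAuction c G, m.2.2 = true ∧
      outer (core c G) m.1 = outer (core c G) b.1 := by
    by_contra! h
    have := hI.aboveGap_of_unmatched (sameOuter_iff hc hb) hB hbst h
    exact hno _ (mem_crown.2 ⟨b, this, rfl⟩) fun a h => (mem_inner.1 h).1
  obtain ⟨m, hm, hfm, hmb⟩ := hmatch
  have ham : a ∈ outer (core c G) m.1 := hmb ▸ mem_outer.2 ⟨ha, haV⟩
  have hmE := hI.mem hm
  have hmG := mem_outsiders.1 hmE
  obtain ⟨f, hf, hmf⟩ := greedy_maximal (r := conflict c) (fun _ => conflict_self)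
    (mem_matched.2 ⟨m, hm, hfm, rfl⟩)
  refine ⟨f, hf, mem_outer.2 ⟨?_, haV⟩⟩
  rw [conflict, Bool.or_eq_true, subs_iff, decide_eq_true_iff] at hmf
  rcases hmf with h | h
  · exact h (mem_outer.1 ham).1
  by_contra haf
  obtain ⟨f', hf', hff, rfl⟩ := mem_matched.1 (weak_subset hf)
  obtain ⟨⟨x, hx⟩, hlen⟩ := outer_inner_spec hc hb hmG.1 hmG.2
  have hxa : a = x := by rwa [hx, List.mem_singleton] at ham
  -- The common elements of the two matching edges fill the whole right end of the first one.
  have hsub : (m.1.filter fun y => decide (y ∈ f'.1)).toFinset ⊆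
      (inner (core c G) m.1).toFinset := by
    intro y hy
    rw [List.mem_toFinset, List.mem_filter, decide_eq_true_iff] at hy
    rw [List.mem_toFinset]
    by_contra hyV
    have : y ∈ outer (core c G) m.1 :=
      mem_outer.2 ⟨hy.1, fun h => hyV (mem_inner.2 ⟨hy.1, h⟩)⟩
    rw [hx, List.mem_singleton] at this
    exact haf (hxa ▸ this ▸ hy.2)
  have heq := Finset.eq_of_subset_of_card_le hsub (by
    rw [card_toFinset_inner hc hb hmG.1 hmG.2,
      List.toFinset_card_of_nodup ((hb _ hmG.1).1.filter _)]
    omega)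
  have hin : sameInner (core c G) m.1 f'.1 = true := by
    rw [sameInner, subs_iff]
    intro y hy
    rw [← List.mem_toFinset, ← heq, List.mem_toFinset, List.mem_filter, decide_eq_true_iff] at hy
    exact hy.2
  have hR := (sameInner_iff hc hb _ hmE _ (hI.mem hf')).1 hin
  have hL := hI.lft_eq m hm f' hf' hfm hff hR
  exact haf (mem_outer.1 (hL ▸ ham)).1

theorem length_core_append_le (hc : 2 ≤ c) (hb : Bounded c G) :
    (core c G ++ (weak c (matched c G)).flatMap (outer (core c G))).length ≤
      (weak c G).length * c + (weak c (matched c G)).length := by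
  rw [List.length_append, List.length_flatMap, core, List.length_flatten]
  refine Nat.add_le_add ?_ ?_
  · have := List.sum_le_card_nsmul ((weak c G).map List.length) c (by
      intro n hn
      obtain ⟨e, he, rfl⟩ := List.mem_map.1 hn
      exact (hb e (weak_subset he)).2)
    simpa using this
  · have := List.sum_le_card_nsmul
      ((weak c (matched c G)).map fun e => (outer (core c G) e).length) 1 (by
      intro n hn
      obtain ⟨e, he, rfl⟩ := List.mem_map.1 hn
      have h := mem_of_mem_matched (weak_subset he)
      obtain ⟨x, hx⟩ := (outer_inner_spec hc hb h.1 h.2).1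
      rw [hx, List.length_singleton])
    simpa [core] using this

end Crown

/-! ### Correctness of the kernelization -/

section Kernel

variable {α : Type} [DecidableEq α] {c k : ℕ} {F : List (List α)} {X : Finset α}

theorem setEq_iff {e f : List α} : setEq e f = true ↔ ∀ a, a ∈ e ↔ a ∈ f := by
  rw [setEq, Bool.and_eq_true, subs_iff, subs_iff]
  exact ⟨fun h a => ⟨@h.1 a, @h.2 a⟩, fun h => ⟨fun a => (h a).1, fun a => (h a).2⟩⟩

theorem meets_greedy_setEq : Meets X (greedy setEq F) ↔ Meets X F := by
  constructor
  · intro h e he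
    obtain ⟨f, hf, hef⟩ := greedy_maximal (r := setEq) (fun e => setEq_iff.2 fun _ => Iff.rfl) he
    obtain ⟨a, ha, haX⟩ := h f hf
    exact ⟨a, (setEq_iff.1 hef a).2 ha, haX⟩
  · exact fun h e he => h e ((greedy_sublist _ F).subset he)

theorem pairwise_kernelSets : (kernelSets c k F).Pairwise fun e f => setEq e f = false := by
  unfold kernelSets
  cases decide (c < 2) || decide (k = 0)
  · exact greedy_pairwise
  · cases decide (k < (greedy setEq F).length)
    · exact greedy_pairwise
    · exact List.pairwise_singleton _ _

theorem kernelSets_of_large (hc : 2 ≤ c) (hk : k ≠ 0) : kernelSets c k F =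
    greedy setEq (contract (crown c (reduced c k F)) (reduced c k F)) := by
  simp [kernelSets, hk, not_lt.2 hc, -not_lt]

theorem kernelSets_of_small (h : c < 2 ∨ k = 0) : kernelSets c k F =
    bif decide (k < (greedy setEq F).length) then [[]] else greedy setEq F := by
  have : (decide (c < 2) || decide (k = 0)) = true := by simpa using h
  rw [kernelSets, this, cond_true]

theorem bounded_reduced (hb : Bounded c F) : Bounded c (reduced c k F) :=
  bounded_iterate_reduce hb _

theorem bounded_kernelSets (hb : Bounded c F) : Bounded c (kernelSets c k F) := by
  intro e he
  have hg : ∀ e ∈ greedy setEq F, e.Nodup ∧ e.length ≤ c := fun e he =>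
    hb e ((greedy_sublist _ F).subset he)
  by_cases h : c < 2 ∨ k = 0
  · rw [kernelSets_of_small h] at he
    cases h' : decide (k < (greedy setEq F).length) <;> rw [h'] at he
    · exact hg e he
    · rw [List.mem_singleton.1 he]
      exact ⟨List.nodup_nil, Nat.zero_le c⟩
  · push Not at h
    rw [kernelSets_of_large h.1 h.2] at he
    have hr := bounded_reduced (k := k) hb
    rcases mem_contract.1 ((greedy_sublist _ _).subset he) with h1 | h1
    · obtain ⟨a, ha, rfl⟩ := mem_crown.1 h1
      have haG := mem_outsiders.1 ((outerAuction_spec h.1 hr).1.mem (mem_aboveGap.1 ha).1)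
      exact ⟨(hr _ haG.1).1.filter _, (List.length_filter_le _ _).trans (hr _ haG.1).2⟩
    · exact hr e h1.1

theorem Meets.of_kernelSets (h : Meets X (kernelSets c k F)) : Meets X F := by
  by_cases hs : c < 2 ∨ k = 0
  · rw [kernelSets_of_small hs] at h
    cases h' : decide (k < (greedy setEq F).length) <;> rw [h'] at h
    · exact meets_greedy_setEq.1 h
    · obtain ⟨a, ha, -⟩ := h [] (List.mem_singleton_self _)
      cases ha
  · push Not at hs
    rw [kernelSets_of_large hs.1 hs.2] at h
    exact (meets_greedy_setEq.1 h).of_contract.of_reduced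

theorem exists_meets_kernelSets (hb : Bounded c F) (hX : X.card ≤ k) (h : Meets X F) :
    ∃ X' : Finset α, X'.card ≤ k ∧ Meets X' (kernelSets c k F) := by
  by_cases hs : c < 2 ∨ k = 0
  · have hg := meets_greedy_setEq.2 h
    rw [kernelSets_of_small hs]
    cases h' : decide (k < (greedy setEq F).length)
    · exact ⟨X, hX, hg⟩
    · exfalso
      have hlt := of_decide_eq_true h'
      -- Sets of at most one element that `X` meets are singletons of elements of `X`.
      have hle : (greedy setEq F).length ≤ X.card := by
        have hnd : (greedy setEq F).Nodup := greedy_pairwise.imp fun {e f} h hef => by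
          rw [← Bool.not_eq_true, setEq_iff] at h
          exact h fun a => by rw [hef]
        have hsub : greedy setEq F ⊆ X.toList.map fun x => [x] := by
          intro e he
          obtain ⟨a, ha, haX⟩ := hg e he
          have hlen := (hb e ((greedy_sublist _ F).subset he)).2
          rcases hs with hs | hs
          · have : e = [a] := by
              match e with
              | [] => cases ha
              | [b] => rw [List.mem_singleton.1 ha]
              | _ :: _ :: _ => simp at hlen; omega
            exact List.mem_map.2 ⟨a, Finset.mem_toList.2 haX, this.symm⟩
          · rw [hs, Nat.le_zero, Finset.card_eq_zero] at hX
            simp [hX] at haX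
        have := length_le_of_nodup_of_subset hnd hsub
        simpa using this
      omega
  · push Not at hs
    obtain ⟨X', hX', h1⟩ := exists_meets_contract_crown hs.1 (bounded_reduced (k := k) hb) hX
      (meets_reduced hs.1 hb hX h)
    rw [kernelSets_of_large hs.1 hs.2]
    exact ⟨X', hX', meets_greedy_setEq.2 h1⟩

/-- The bound on the number of elements of the kernel. -/
theorem length_le_of_subset_kernelSets (hc : 1 ≤ c) (hb : Bounded c F) {U : List α}
    (hU : U.Nodup) (h : ∀ a ∈ U, ∃ e ∈ kernelSets c k F, a ∈ e) :
    U.length ≤ (2 * c - 1) * k ^ (c - 1) + k := by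
  by_cases hs : c < 2 ∨ k = 0
  · rw [kernelSets_of_small hs] at h
    have hUk : U.length ≤ k * c := by
      cases h' : decide (k < (greedy setEq F).length) <;> rw [h'] at h
      · have h1 := length_le_of_nodup_of_subset hU (l₂ := (greedy setEq F).flatten)
          fun a ha => List.mem_flatten.2 (h a ha)
        have h2 := List.sum_le_card_nsmul ((greedy setEq F).map List.length) c (by
          intro n hn
          obtain ⟨e, he, rfl⟩ := List.mem_map.1 hn
          exact (hb e ((greedy_sublist _ F).subset he)).2)
        rw [List.length_map, smul_eq_mul, ← List.length_flatten] at h2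
        refine h1.trans (h2.trans ?_)
        gcongr
        exact not_lt.1 (of_decide_eq_false h')
      · have : U = [] := List.eq_nil_iff_forall_not_mem.2 fun a ha => by simpa using h a ha
        simp [this]
    rcases hs with hs | hs
    · obtain rfl : c = 1 := by omega
      omega
    · rw [hs] at hUk
      omega
  · push Not at hs
    rw [kernelSets_of_large hs.1 hs.2] at h
    have hr := bounded_reduced (k := k) hb
    have h1 := length_le_of_nodup_of_subset hU fun a ha =>
      let ⟨e, he, hae⟩ := h a ha
      mem_core_or_mem_outer hs.1 hr ((greedy_sublist _ _).subset he) hae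
    have h2 := length_core_append_le hs.1 hr
    obtain ⟨h3, h4⟩ := length_weak_reduced_le (c := c) (F := F) hs.2
    have h5 : (weak c (reduced c k F)).length * c ≤ k ^ (c - 1) * c := by gcongr
    have h6 : (c + 1) * k ^ (c - 1) ≤ (2 * c - 1) * k ^ (c - 1) := by
      gcongr
      omega
    rw [Nat.add_mul, one_mul, mul_comm c] at h6
    omega

end Kernel

/-! ### From overlays to hitting sets and back -/

section Overlay

/-- The users that have a bit at position `t` of their row. -/
def usersOf (n : ℕ) (rows : List (List Bool)) (t : ℕ) : List ℕ :=
  (List.range n).filter fun u => (rows.getD u []).getD t false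

/-- The edges between `A` and the rest of `U`, each with its smaller end first. -/
def cut (U A : List ℕ) : List (ℕ × ℕ) :=
  greedy (fun p q => decide (p = q)) (A.flatMap fun a => (U.filter fun b => !decide (b ∈ A)).map
    fun b => bif decide (a < b) then (a, b) else (b, a))

/-- The cuts of a set of at most `d` users. -/
def cutsOf (d : ℕ) (U : List ℕ) : List (List (ℕ × ℕ)) :=
  ((subl d U).filter fun A => !A.isEmpty && !subs U A).map (cut U)

/-- The cuts of all the sets `U_t` of an instance. -/
def cuts (d : ℕ) (I : ℕ × ℕ × List (List Bool)) : List (List (ℕ × ℕ)) :=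
  (List.range I.2.1).flatMap fun t => cutsOf d (usersOf I.1 I.2.2 t)

/-- The entries of all lists in `K`, without repetition. -/
def support {α : Type} [DecidableEq α] (K : List (List α)) : List α :=
  greedy (fun p q => decide (p = q)) K.flatten

/-- The instance of the hitting set problem that is given by the family `K`. -/
def incidence {α : Type} [DecidableEq α] (K : List (List α)) : ℕ × ℕ × List (List Bool) :=
  ((support K).length, K.length, K.map fun e => (support K).map fun a => decide (a ∈ e))

/-- The entries of `U` at the positions that `h` marks. -/
def select (U : List (ℕ × ℕ)) (h : List Bool) : List (ℕ × ℕ) :=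
  ((List.range U.length).filter fun i => h.getD i false).map fun i => U.getD i (0, 0)

/-- The adjacency matrix of the graph on `n` vertices whose edges are listed in `Y`. -/
def adjacency (n : ℕ) (Y : List (ℕ × ℕ)) : List (List Bool) :=
  (List.range n).map fun u => (List.range n).map fun v =>
    !decide (u = v) && Y.any fun p => decide (p = (u, v)) || decide (p = (v, u))

/-- The kernelization. -/
def kernelMap (c d : ℕ) (x : (ℕ × ℕ × List (List Bool)) × ℕ) :
    (ℕ × ℕ × List (List Bool)) × ℕ :=
  (incidence (kernelSets c x.2 (cuts d x.1)), x.2)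

/-- The transformation of hitting sets of the kernel into overlays. -/
def liftMap (c d : ℕ) (x : ((ℕ × ℕ × List (List Bool)) × ℕ) × List (List Bool)) :
    List (List Bool) :=
  adjacency x.1.1.1 (select (support (kernelSets c x.1.2 (cuts d x.1.1))) (x.2.headD []))

variable {Γ α : Type} [Enc Γ]

@[fun_prop]
theorem PolyTime.usersOf {n t : Γ → ℕ} {rows : Γ → List (List Bool)} (hn : PolyTime n)
    (hr : PolyTime rows) (ht : PolyTime t) :
    PolyTime fun γ => usersOf (n γ) (rows γ) (t γ) := by
  unfold TCOKernel.usersOf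
  fun_prop

@[fun_prop]
theorem PolyTime.cut {U A : Γ → List ℕ} (hU : PolyTime U) (hA : PolyTime A) :
    PolyTime fun γ => cut (U γ) (A γ) := by
  unfold TCOKernel.cut
  exact PolyTime.greedy (r := fun _ p q => decide (p = q)) (by fun_prop) (by fun_prop)

@[fun_prop]
theorem PolyTime.cutsOf {d : ℕ} {U : Γ → List ℕ} (hU : PolyTime U) :
    PolyTime fun γ => cutsOf d (U γ) := by
  unfold TCOKernel.cutsOf
  fun_prop

@[fun_prop]
theorem PolyTime.cuts {d : ℕ} {I : Γ → ℕ × ℕ × List (List Bool)} (hI : PolyTime I) :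
    PolyTime fun γ => cuts d (I γ) := by
  unfold TCOKernel.cuts
  fun_prop

@[fun_prop]
theorem PolyTime.support [Enc α] [DecidableEq α] [PolyEq α] {K : Γ → List (List α)}
    (hK : PolyTime K) : PolyTime fun γ => support (K γ) := by
  unfold TCOKernel.support
  exact PolyTime.greedy (r := fun _ p q => decide (p = q)) (by fun_prop) (by fun_prop)

@[fun_prop]
theorem PolyTime.incidence [Enc α] [DecidableEq α] [PolyEq α] {K : Γ → List (List α)}
    (hK : PolyTime K) : PolyTime fun γ => incidence (K γ) := by
  unfold TCOKernel.incidence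
  fun_prop

@[fun_prop]
theorem PolyTime.select {U : Γ → List (ℕ × ℕ)} {h : Γ → List Bool} (hU : PolyTime U)
    (hh : PolyTime h) : PolyTime fun γ => select (U γ) (h γ) := by
  unfold TCOKernel.select
  fun_prop

@[fun_prop]
theorem PolyTime.adjacency {n : Γ → ℕ} {Y : Γ → List (ℕ × ℕ)} (hn : PolyTime n)
    (hY : PolyTime Y) : PolyTime fun γ => adjacency (n γ) (Y γ) := by
  unfold TCOKernel.adjacency
  exact PolyTime.map (PolyTime.map (by fun_prop) (by fun_prop)) (by fun_prop)

theorem polyTime_kernelMap (c d : ℕ) : PolyTime (kernelMap c d) := by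
  unfold kernelMap
  fun_prop

theorem polyTime_liftMap (c d : ℕ) : PolyTime (liftMap c d) := by
  unfold liftMap
  fun_prop

end Overlay

/-! ### Hitting set instances -/

section HittingSet

variable {α : Type} [DecidableEq α] {K : List (List α)} {c : ℕ}

theorem ofMatrix_eq {m n : ℕ} (r : Fin m → Fin n → Prop) [∀ i j, Decidable (r i j)] :
    Data.ofMatrix r = enc (List.ofFn fun i => List.ofFn fun j => decide (r i j)) := by
  change _ = Data.ofList (List.map enc _)
  rw [Data.ofMatrix, List.map_ofFn]
  congr 2
  funext i
  change _ = Data.ofList (List.map enc _)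
  rw [List.map_ofFn]
  rfl

theorem nodup_support : (support K).Nodup :=
  greedy_pairwise.imp fun h => of_decide_eq_false h

theorem mem_support {a : α} : a ∈ support K ↔ ∃ e ∈ K, a ∈ e := by
  rw [← List.mem_flatten]
  constructor
  · exact fun h => (greedy_sublist _ _).subset h
  · intro h
    obtain ⟨b, hb, hab⟩ := greedy_maximal (r := fun p q => decide (p = q))
      (fun a => decide_eq_true rfl) h
    rwa [of_decide_eq_true hab]

/-- The hitting set instance given by a family of lists that differ as sets; its elements number
the entries of the lists. -/
def toInstance (K : List (List α)) (hK : K.Pairwise fun e f => setEq e f = false) :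
    HSInstance where
  elements := (support K).length
  numSets := K.length
  sets i := Finset.univ.filter fun j => (support K)[j] ∈ K[i]
  distinct := by
    have key : ∀ i j : Fin K.length,
        (Finset.univ.filter fun x : Fin (support K).length => (support K)[x] ∈ K[i]) =
          (Finset.univ.filter fun x : Fin (support K).length => (support K)[x] ∈ K[j]) →
        setEq K[i] K[j] = true := by
      intro i j hij
      rw [setEq_iff]
      intro a
      by_cases ha : a ∈ support K
      · obtain ⟨x, hx, rfl⟩ := List.getElem_of_mem ha
        simpa using Finset.ext_iff.1 hij ⟨x, hx⟩
      · rw [mem_support] at ha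
        push Not at ha
        exact iff_of_false (ha _ (List.getElem_mem _)) (ha _ (List.getElem_mem _))
    rw [List.pairwise_iff_getElem] at hK
    intro i j hij
    rcases lt_trichotomy i j with h | h | h
    · have := (hK i j i.2 j.2 h).symm.trans (key i j hij)
      cases this
    · exact h
    · have := (hK j i j.2 i.2 h).symm.trans (key j i hij.symm)
      cases this

variable (hK : K.Pairwise fun e f => setEq e f = false)

theorem mem_sets_toInstance {i : Fin K.length} {j : Fin (support K).length} :
    (show Fin (toInstance K hK).elements from j) ∈ (toInstance K hK).sets i ↔
      (support K)[j] ∈ K[i] :=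
  Finset.mem_filter.trans (and_iff_right (Finset.mem_univ j))

theorem encode_toInstance : (toInstance K hK).encode = enc (incidence K) := by
  rw [HSInstance.encode, ofMatrix_eq]
  have h (e : List α) : (List.ofFn fun j : Fin (support K).length =>
      decide ((support K)[j] ∈ e)) = (support K).map fun a => decide (a ∈ e) :=
    List.ofFn_getElem_eq_map (support K) fun a => decide (a ∈ e)
  have h' : (List.ofFn fun i : Fin K.length => List.ofFn fun j : Fin (support K).length =>
      decide ((support K)[j] ∈ K[i])) = K.map fun e => (support K).map fun a => decide (a ∈ e) := by
    simp only [h]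
    exact List.ofFn_getElem_eq_map K fun e => (support K).map fun a => decide (a ∈ e)
  rw [incidence, ← h']
  refine congrArg (fun M => Data.cons _ (Data.cons _ (enc M)))
    (congrArg List.ofFn (funext fun i => congrArg List.ofFn (funext fun j => ?_)))
  exact decide_eq_decide.2 (mem_sets_toInstance hK)

theorem card_sets_toInstance_le (hb : Bounded c K) (i : Fin (toInstance K hK).numSets) :
    ((toInstance K hK).sets i).card ≤ c := by
  refine le_trans ?_ (hb K[i] (List.getElem_mem _)).2
  rw [← List.toFinset_card_of_nodup (hb K[i] (List.getElem_mem _)).1]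
  refine Finset.card_le_card_of_injOn (fun j : Fin (support K).length => (support K)[j])
    (fun j hj => ?_) ?_
  · exact List.mem_toFinset.2 ((mem_sets_toInstance hK).1 hj)
  · intro x _ y _ hxy
    exact Fin.ext ((nodup_support.getElem_inj_iff).1 hxy)

theorem hits_iff_meets (H : Finset (Fin (support K).length)) :
    (toInstance K hK).Hits H ↔ Meets (H.image fun j => (support K)[j]) K := by
  constructor
  · intro h e he
    obtain ⟨i, hi, rfl⟩ := List.getElem_of_mem he
    obtain ⟨j, hj⟩ := h ⟨i, hi⟩
    obtain ⟨hj, hjH⟩ := Finset.mem_inter.1 hj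
    exact ⟨_, (mem_sets_toInstance hK).1 hj, Finset.mem_image_of_mem _ hjH⟩
  · intro h i
    obtain ⟨a, ha, haH⟩ := h K[i] (List.getElem_mem _)
    obtain ⟨j, hj, rfl⟩ := Finset.mem_image.1 haH
    exact ⟨j, Finset.mem_inter.2 ⟨(mem_sets_toInstance hK).2 ha, hj⟩⟩

theorem exists_hits {X : Finset α} (h : Meets X K) :
    ∃ H : Finset (Fin (toInstance K hK).elements), (toInstance K hK).Hits H ∧ H.card ≤ X.card := by
  let H : Finset (Fin (support K).length) := Finset.univ.filter fun j => (support K)[j] ∈ X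
  refine ⟨H, (hits_iff_meets hK H).2 fun e he => ?_, ?_⟩
  · obtain ⟨a, ha, haX⟩ := h e he
    obtain ⟨j, hj, rfl⟩ := List.getElem_of_mem (mem_support.2 ⟨e, he, ha⟩)
    exact ⟨_, ha, Finset.mem_image.2
      ⟨⟨j, hj⟩, Finset.mem_filter.2 ⟨Finset.mem_univ _, haX⟩, rfl⟩⟩
  · refine Finset.card_le_card_of_injOn (fun j : Fin (support K).length => (support K)[j])
      (fun j hj => (Finset.mem_filter.1 hj).2) ?_
    intro x _ y _ hxy
    exact Fin.ext ((nodup_support.getElem_inj_iff).1 hxy)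

end HittingSet

/-! ### Cuts -/

section Cuts

variable {d : ℕ} {U A : List ℕ} {e : List (ℕ × ℕ)} {p : ℕ × ℕ}

theorem mem_cut : p ∈ cut U A ↔
    ∃ a ∈ A, ∃ b ∈ U, b ∉ A ∧ (bif decide (a < b) then (a, b) else (b, a)) = p := by
  have : p ∈ cut U A ↔ p ∈ A.flatMap fun a => (U.filter fun b => !decide (b ∈ A)).map
      fun b => bif decide (a < b) then (a, b) else (b, a) := by
    constructor
    · exact fun h => (greedy_sublist _ _).subset h
    · intro h
      obtain ⟨q, hq, hpq⟩ := greedy_maximal (r := fun p q => decide (p = q))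
        (fun a => decide_eq_true rfl) h
      rwa [of_decide_eq_true hpq]
  rw [this]
  simp [and_assoc]

theorem mem_cutsOf : e ∈ cutsOf d U ↔ ∃ A ∈ subl d U, A ≠ [] ∧ ¬ U ⊆ A ∧ cut U A = e := by
  simp [cutsOf, ← subs_iff, and_assoc]

theorem mul_le_of_add_le {a b : ℕ} (h : a + b ≤ d) : a * b ≤ (d / 2) * ((d + 1) / 2) := by
  have h4 : 4 * (a * b) ≤ d * d := by
    have h1 : (a + b) * (a + b) ≤ d * d := Nat.mul_le_mul h h
    nlinarith [sq_nonneg ((a : ℤ) - b), four_mul_le_sq_add (a : ℤ) b]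
  obtain ⟨m, rfl | rfl⟩ : ∃ m, d = 2 * m ∨ d = 2 * m + 1 := ⟨d / 2, by omega⟩
  · rw [show 2 * m / 2 = m by omega, show (2 * m + 1) / 2 = m by omega]
    nlinarith
  · rw [show (2 * m + 1) / 2 = m by omega, show (2 * m + 1 + 1) / 2 = m + 1 by omega]
    have : 4 * (a * b) ≤ 4 * (m * (m + 1)) + 1 := by nlinarith
    omega

theorem bounded_cutsOf (hU : U.Nodup) (hlen : U.length ≤ d) :
    Bounded ((d / 2) * ((d + 1) / 2)) (cutsOf d U) := by
  intro e he
  obtain ⟨A, hA, -, -, rfl⟩ := mem_cutsOf.1 he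
  have hAU := sublist_of_mem_subl hA
  refine ⟨greedy_pairwise.imp fun h => of_decide_eq_false h, ?_⟩
  refine (greedy_sublist _ _).length_le.trans ?_
  rw [List.length_flatMap]
  simp only [List.length_map, List.map_const', List.sum_replicate, smul_eq_mul]
  refine mul_le_of_add_le (le_trans ?_ hlen)
  rw [List.length_eq_length_filter_add (l := U) fun a => decide (a ∈ A)]
  refine Nat.add_le_add_right (length_le_of_nodup_of_subset (hU.sublist hAU) fun a ha => ?_) _
  exact List.mem_filter.2 ⟨hAU.subset ha, decide_eq_true ha⟩

end Cuts

/-! ### Overlays and cuts -/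

section Instance

variable (I : TCOInstance)

/-- The data of an instance with its interest matrix. -/
def instData : ℕ × ℕ × List (List Bool) :=
  (I.users, I.topics, List.ofFn fun u => List.ofFn fun t => decide (t ∈ I.interest u))

theorem encode_eq : I.encode = enc (instData I) := by
  rw [TCOInstance.encode, ofMatrix_eq]
  rfl

theorem mem_usersOf {t : Fin I.topics} {a : ℕ} :
    a ∈ usersOf I.users (instData I).2.2 t ↔ ∃ h : a < I.users, t ∈ I.interest ⟨a, h⟩ := by
  rw [usersOf, List.mem_filter, List.mem_range, instData]
  constructor
  · rintro ⟨h, h'⟩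
    refine ⟨h, ?_⟩
    simpa [h] using h'
  · rintro ⟨h, h'⟩
    refine ⟨h, ?_⟩
    simpa [h] using h'

theorem nodup_usersOf (n : ℕ) (rows : List (List Bool)) (t : ℕ) : (usersOf n rows t).Nodup :=
  List.nodup_range.filter _

theorem length_usersOf (t : Fin I.topics) :
    (usersOf I.users (instData I).2.2 t).length = (I.interested t).card := by
  rw [← List.toFinset_card_of_nodup (nodup_usersOf _ _ _),
    ← Finset.card_map (Fin.valEmbedding (n := I.users))]
  congr 1
  ext a
  rw [List.mem_toFinset, mem_usersOf, Finset.mem_map]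
  constructor
  · rintro ⟨h, h'⟩
    exact ⟨⟨a, h⟩, Finset.mem_filter.2 ⟨Finset.mem_univ _, h'⟩, rfl⟩
  · rintro ⟨u, hu, rfl⟩
    exact ⟨u.2, (Finset.mem_filter.1 hu).2⟩

theorem mem_cuts {d : ℕ} {e : List (ℕ × ℕ)} : e ∈ cuts d (instData I) ↔
    ∃ t : Fin I.topics, e ∈ cutsOf d (usersOf I.users (instData I).2.2 t) := by
  rw [cuts, List.mem_flatMap]
  constructor
  · rintro ⟨t, ht, he⟩
    exact ⟨⟨t, List.mem_range.1 ht⟩, he⟩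
  · rintro ⟨t, he⟩
    exact ⟨t, List.mem_range.2 t.2, he⟩

theorem bounded_cuts {d : ℕ} (hI : ∀ t, (I.interested t).card ≤ d) :
    Bounded ((d / 2) * ((d + 1) / 2)) (cuts d (instData I)) := by
  intro e he
  obtain ⟨t, he⟩ := (mem_cuts I).1 he
  exact bounded_cutsOf (nodup_usersOf _ _ _) ((length_usersOf I t).trans_le (hI t)) e he

/-- The pairs of users that stand for the edges in `E`, each with its smaller user first. -/
def pairsOf {n : ℕ} (E : Finset (Sym2 (Fin n))) : Finset (ℕ × ℕ) :=
  E.image fun e => (e.inf.val, e.sup.val)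

theorem mem_pairsOf {n : ℕ} {E : Finset (Sym2 (Fin n))} {a b : Fin n} (h : s(a, b) ∈ E) :
    (bif decide (a.val < b.val) then (a.val, b.val) else (b.val, a.val)) ∈ pairsOf E := by
  refine Finset.mem_image.2 ⟨_, h, ?_⟩
  rw [Sym2.inf_mk, Sym2.sup_mk]
  by_cases hab : a.val < b.val
  · rw [decide_eq_true hab, cond_true, inf_eq_left.2 (Fin.le_def.2 hab.le),
      sup_eq_right.2 (Fin.le_def.2 hab.le)]
  · rw [decide_eq_false hab, cond_false, inf_eq_right.2 (Fin.le_def.2 (not_lt.1 hab)),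
      sup_eq_left.2 (Fin.le_def.2 (not_lt.1 hab))]

/-- A topic-connected overlay has an edge across every cut. -/
theorem meets_cuts_of_topicConnected (d : ℕ) {E : Finset (Sym2 (Fin I.users))}
    (hE : I.TopicConnected E) : Meets (pairsOf E) (cuts d (instData I)) := by
  intro e he
  obtain ⟨t, he⟩ := (mem_cuts I).1 he
  obtain ⟨A, hA, hne, hsub, rfl⟩ := mem_cutsOf.1 he
  obtain ⟨a, ha⟩ := List.exists_mem_of_ne_nil A hne
  rw [List.subset_def] at hsub
  push Not at hsub
  obtain ⟨b, hb, hbA⟩ := hsub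
  obtain ⟨han, hat⟩ := (mem_usersOf I).1 ((sublist_of_mem_subl hA).subset ha)
  obtain ⟨hbn, hbt⟩ := (mem_usersOf I).1 hb
  have hmem : ∀ u : Fin I.users, t ∈ I.interest u → u ∈ (I.interested t : Set (Fin I.users)) :=
    fun u hu => Finset.mem_coe.2 (Finset.mem_filter.2 ⟨Finset.mem_univ _, hu⟩)
  obtain ⟨w⟩ := hE.2 t ⟨⟨a, han⟩, hmem _ hat⟩ ⟨⟨b, hbn⟩, hmem _ hbt⟩
  obtain ⟨x, -, hx1, hx2⟩ := w.exists_boundary_dart {u | u.1.val ∈ A} ha hbA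
  have hadj := x.adj
  rw [SimpleGraph.induce_adj, SimpleGraph.fromEdgeSet_adj] at hadj
  refine ⟨_, mem_cut.2 ⟨_, hx1, _, ?_, hx2, rfl⟩, mem_pairsOf hadj.1⟩
  have := x.snd.2
  exact (mem_usersOf I).2 ⟨x.snd.1.2, (Finset.mem_filter.1 (Finset.mem_coe.1 this)).2⟩

/-- The edges between distinct users that are listed in `Y`, in either direction. -/
noncomputable def edgesOf (n : ℕ) (Y : Finset (ℕ × ℕ)) : Finset (Sym2 (Fin n)) :=
  open Classical in
  Finset.univ.filter fun e => ¬ e.IsDiag ∧ ∃ p ∈ Y, e.map Fin.val = s(p.1, p.2)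

theorem mem_edgesOf {n : ℕ} {Y : Finset (ℕ × ℕ)} {u v : Fin n} : s(u, v) ∈ edgesOf n Y ↔
    u ≠ v ∧ ∃ p ∈ Y, p = (u.val, v.val) ∨ p = (v.val, u.val) := by
  rw [edgesOf, Finset.mem_filter, and_iff_right (Finset.mem_univ _), Sym2.mk_isDiag_iff]
  refine and_congr_right fun _ => exists_congr fun p => and_congr_right fun _ => ?_
  rw [Sym2.map_mk, Sym2.eq_iff, Prod.ext_iff, Prod.ext_iff]
  exact or_congr (and_congr eq_comm eq_comm) ⟨fun h => ⟨h.2.symm, h.1.symm⟩,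
    fun h => ⟨h.2.symm, h.1.symm⟩⟩

theorem card_edgesOf_le (n : ℕ) (Y : Finset (ℕ × ℕ)) : (edgesOf n Y).card ≤ Y.card := by
  classical
  refine le_trans ?_ (Finset.card_image_le (s := Y) (f := fun p => s(p.1, p.2)))
  refine Finset.card_le_card_of_injOn (Sym2.map Fin.val) (fun e he => ?_)
    (Sym2.map.injective Fin.val_injective).injOn
  obtain ⟨-, -, p, hp, h⟩ := Finset.mem_filter.1 he
  exact Finset.mem_image.2 ⟨p, hp, h.symm⟩

/-- Edges across all cuts make an overlay topic-connected: otherwise the component of a user in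
some `U_t` would give an uncrossed cut. -/
theorem topicConnected_of_meets_cuts {d : ℕ} (hI : ∀ t, (I.interested t).card ≤ d)
    {Y : Finset (ℕ × ℕ)} (hY : Meets Y (cuts d (instData I))) :
    I.TopicConnected (edgesOf I.users Y) := by
  classical
  refine ⟨fun e he => (Finset.mem_filter.1 he).2.1, fun t u v => ?_⟩
  set H := (SimpleGraph.fromEdgeSet (edgesOf I.users Y : Set (Sym2 (Fin I.users)))).induce
    (I.interested t : Set (Fin I.users))
  by_contra hno
  let U := usersOf I.users (instData I).2.2 t
  have hmemU : ∀ w : (I.interested t : Set (Fin I.users)), w.1.val ∈ U := fun w =>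
    (mem_usersOf I).2 ⟨w.1.2, (Finset.mem_filter.1 (Finset.mem_coe.1 w.2)).2⟩
  let A := U.filter fun a => decide (∃ w, w.1.val = a ∧ H.Reachable u w)
  have hmemA : ∀ w : (I.interested t : Set (Fin I.users)), w.1.val ∈ A ↔ H.Reachable u w := by
    intro w
    rw [List.mem_filter, decide_eq_true_iff]
    constructor
    · rintro ⟨-, w', hw', h⟩
      rwa [Subtype.ext (Fin.ext hw')] at h
    · exact fun h => ⟨hmemU w, w, rfl, h⟩
  have hcut : cut U A ∈ cuts d (instData I) := by
    refine (mem_cuts I).2 ⟨t, mem_cutsOf.2 ⟨A, filter_mem_subl _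
      ((length_usersOf I t).trans_le (hI t)), ?_, ?_, rfl⟩⟩
    · exact List.ne_nil_of_mem ((hmemA u).2 (SimpleGraph.Reachable.refl u))
    · exact fun h => hno ((hmemA v).1 (h (hmemU v)))
  obtain ⟨p, hp, hpY⟩ := hY _ hcut
  obtain ⟨a, ha, b, hb, hbA, rfl⟩ := mem_cut.1 hp
  obtain ⟨haU, har⟩ := List.mem_filter.1 ha
  obtain ⟨w, rfl, hw⟩ := of_decide_eq_true har
  obtain ⟨hbn, hbt⟩ := (mem_usersOf I).1 hb
  let z : (I.interested t : Set (Fin I.users)) :=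
    ⟨⟨b, hbn⟩, Finset.mem_coe.2 (Finset.mem_filter.2 ⟨Finset.mem_univ _, hbt⟩)⟩
  have hwz : w.1 ≠ z.1 := by
    intro h
    have hb' : w.1.val = b := congrArg Fin.val h
    rw [← hb'] at hbA
    exact hbA ha
  have hadj : H.Adj w z := by
    rw [SimpleGraph.induce_adj, SimpleGraph.fromEdgeSet_adj]
    refine ⟨Finset.mem_coe.2 (mem_edgesOf.2 ⟨hwz, _, hpY, ?_⟩), hwz⟩
    cases decide (w.1.val < b)
    · exact .inr rfl
    · exact .inl rfl
  exact hbA ((hmemA z).2 (hw.trans hadj.reachable))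

end Instance

/-! ### Encodings of solutions -/

section Decoding

theorem range_map_eq_ofFn {β : Type} (n : ℕ) (f : ℕ → β) :
    (List.range n).map f = List.ofFn fun i : Fin n => f i := by
  refine List.ext_getElem (by simp) fun i h1 h2 => ?_
  simp

theorem encodeCand_edgesOf (n : ℕ) (L : List (ℕ × ℕ)) :
    Data.ofMatrix (fun u v => s(u, v) ∈ edgesOf n L.toFinset) = enc (adjacency n L) := by
  rw [ofMatrix_eq, adjacency, range_map_eq_ofFn]
  congr 2
  funext u
  rw [range_map_eq_ofFn]
  congr 1
  funext v
  rw [Bool.eq_iff_iff, decide_eq_true_iff, mem_edgesOf]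
  simp [Fin.ext_iff]

theorem toFinset_select {U : List (ℕ × ℕ)} (H : Finset (Fin U.length)) :
    (select U (List.ofFn fun j => decide (j ∈ H))).toFinset = H.image fun j => U[j] := by
  ext p
  rw [List.mem_toFinset, select, List.mem_map, Finset.mem_image]
  constructor
  · rintro ⟨i, hi, rfl⟩
    obtain ⟨hi, hiH⟩ := List.mem_filter.1 hi
    rw [List.mem_range] at hi
    refine ⟨⟨i, hi⟩, by simpa [hi] using hiH, by simp [hi]⟩
  · rintro ⟨j, hj, rfl⟩
    exact ⟨j, List.mem_filter.2 ⟨List.mem_range.2 j.2, by simpa using hj⟩, by simp⟩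

end Decoding

/-! ### The kernel -/

theorem esize_matrix_le {L : List (List Bool)} {m n : ℕ} (hm : L.length ≤ m)
    (hn : ∀ l ∈ L, l.length ≤ n) : esize L ≤ m * (n * 4 + 2) + 1 :=
  esize_list_le hm fun l hl => esize_list_le (hn l hl) fun b _ => esize_bool b

theorem esize_instData_le (I : TCOInstance) (k : ℕ) :
    esize (instData I, k) ≤ (10 * (Polynomial.X + 1) ^ 2 : Polynomial ℕ).eval
      (I.users + I.topics + k) := by
  have h : esize (instData I).2.2 ≤ I.users * (I.topics * 4 + 2) + 1 := by
    refine esize_matrix_le (by simp [instData]) fun l hl => ?_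
    obtain ⟨u, rfl⟩ := (List.mem_ofFn' _ _).1 hl
    simp
  have h' : esize (instData I, k) = esize I.users + (esize I.topics + esize (instData I).2.2 + 1)
      + 1 + esize k + 1 := rfl
  rw [h', esize_nat, esize_nat, esize_nat]
  simp only [Polynomial.eval_mul, Polynomial.eval_pow, Polynomial.eval_add, Polynomial.eval_X,
    Polynomial.eval_one, Polynomial.eval_ofNat]
  nlinarith [Nat.zero_le (I.users * k), Nat.zero_le (I.topics * k)]

theorem hasKernel_hittingSet {d c : ℕ} (hd : 2 ≤ d) (hc : c = (d / 2) * ((d + 1) / 2)) :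
    (minTCO d).HasKernel (hittingSet c) (fun J => J.1.elements)
      (fun k => (2 * c - 1) * k ^ (c - 1) + k) := by
  have hc1 : 1 ≤ c := by
    rw [hc]
    exact Nat.mul_pos (by omega) (by omega)
  obtain ⟨K, TK, hK⟩ := polyTime_kernelMap c d
  obtain ⟨L, TL, hL⟩ := polyTime_liftMap c d
  -- `S` bounds the size of the input of `K`; that of `L` also contains a row with one bit for each
  -- element of the kernel, of which there are no more than `K` has time to write.
  let S : Polynomial ℕ := 10 * (Polynomial.X + 1) ^ 2
  refine ⟨K, L, TK.comp S + TL.comp (S + (4 * TK.comp S + 4)), fun ⟨I, hI⟩ k => ?_⟩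
  have hb : Bounded c (cuts d (instData I)) := hc ▸ bounded_cuts I hI
  set F := kernelSets c k (cuts d (instData I)) with hF
  have hpw : F.Pairwise fun e f => setEq e f = false := pairwise_kernelSets
  have hin : (minTCO d).encodeParam ⟨I, hI⟩ k = enc (instData I, k) :=
    congrArg (Data.cons · (Data.ofNat k)) (encode_eq I)
  have hout : (hittingSet c).encodeParam
      ⟨toInstance F hpw, card_sets_toInstance_le hpw (bounded_kernelSets hb)⟩ k =
        enc (kernelMap c d (instData I, k)) :=
    congrArg (Data.cons · (Data.ofNat k)) (encode_toInstance hpw)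
  have hsize : esize (instData I, k) ≤ S.eval ((minTCO d).size ⟨I, hI⟩ + k) :=
    esize_instData_le I k
  have hrunK := (hK (instData I, k)).mono (eval_mono TK hsize)
  have back : ∀ H : Finset (Fin (support F).length),
      (hittingSet c).Solves
        ⟨toInstance F hpw, card_sets_toInstance_le hpw (bounded_kernelSets hb)⟩ k H →
      (minTCO d).Solves ⟨I, hI⟩ k (edgesOf I.users (H.image fun j => (support F)[j])) := by
    intro H hH
    refine ⟨topicConnected_of_meets_cuts I hI ?_, ?_⟩
    · exact ((hits_iff_meets hpw H).1 hH.1).of_kernelSets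
    · exact (card_edgesOf_le _ _).trans (Finset.card_image_le.trans hH.2)
  refine ⟨⟨toInstance F hpw, card_sets_toInstance_le hpw (bounded_kernelSets hb)⟩, k, ?_, ?_,
    le_rfl, ⟨?_, ?_⟩, ?_⟩
  · rw [hin, hout]
    exact hrunK.mono (by rw [Polynomial.eval_add, Polynomial.eval_comp]; omega)
  · exact length_le_of_subset_kernelSets hc1 hb nodup_support fun a ha => mem_support.1 ha
  · rintro ⟨E, hE, hEk⟩
    have hcard : (pairsOf E).card ≤ k := Finset.card_image_le.trans hEk
    obtain ⟨X, hX, hXF⟩ := exists_meets_kernelSets hb hcard (meets_cuts_of_topicConnected I d hE)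
    obtain ⟨H, hH, hHX⟩ := exists_hits hpw hXF
    exact ⟨H, hH, hHX.trans hX⟩
  · rintro ⟨H, hH⟩
    exact ⟨_, back H hH⟩
  · intro (H : Finset (Fin (support F).length)) hH
    refine ⟨_, back H hH, ?_⟩
    let h : List (List Bool) := List.ofFn fun _ : Fin 1 => List.ofFn fun j => decide (j ∈ H)
    have hcand : (hittingSet c).encodeCand
        ⟨toInstance F hpw, card_sets_toInstance_le hpw (bounded_kernelSets hb)⟩ H = enc h :=
      ofMatrix_eq fun (_ : Fin 1) (j : Fin (support F).length) => j ∈ H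
    have hsol : (minTCO d).encodeCand ⟨I, hI⟩
        (edgesOf I.users (H.image fun j => (support F)[j])) =
          enc (liftMap c d ((instData I, k), h)) := by
      rw [← toFinset_select]
      exact encodeCand_edgesOf _ _
    rw [hin, hcand, hsol]
    refine (hL ((instData I, k), h)).mono ?_
    have hlen : (support F).length ≤ TK.eval (S.eval ((minTCO d).size ⟨I, hI⟩ + k)) := by
      have h1 : esize (support F).length ≤ esize (kernelMap c d (instData I, k)) := by
        change _ ≤ esize (support F).length + _ + 1 + _ + 1
        omega
      have h2 := h1.trans hrunK.size_le
      rw [esize_nat] at h2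
      omega
    have hh : esize h ≤ 1 * ((support F).length * 4 + 2) + 1 :=
      esize_matrix_le (by simp [h]) (by simp [h])
    have hle : esize ((instData I, k), h) ≤
        (S + (4 * TK.comp S + 4)).eval ((minTCO d).size ⟨I, hI⟩ + k) := by
      rw [esize_pair]
      simp only [Polynomial.eval_add, Polynomial.eval_comp, Polynomial.eval_mul,
        Polynomial.eval_ofNat]
      omega
    have := eval_mono TL hle
    rw [Polynomial.eval_add, Polynomial.eval_comp (p := TL)]
    omega

end TCOKernel

theorem mainTheorem9 (d c : ℕ) (hd : 2 ≤ d) (hc : c = (d / 2) * ((d + 1) / 2)) :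
    (TCOKernel.minTCO d).HasKernel (TCOKernel.hittingSet c) (fun J => J.1.elements)
      (fun k => (2 * c - 1) * k ^ (c - 1) + k) :=
  TCOKernel.hasKernel_hittingSet hd hc
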